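/- **Setting.** There are $n\ge 1$ workers. Worker $i$ has a data distribution $\mathcal D_i$ and sample losses $f_i(x;z)$, $x\in\mathbb R^d$; put $f_i(x)=\mathbb E_{z\sim\mathcal D_i}f_i(x;z)$ and $f=\frac1n\sum_{i=1}^n f_i$. Assume: 1. for all $i$ and $z$, $f_i(\cdot;z)$ is differentiable, and for all $i$ and $x$, $\mathbb E_{z\sim\mathcal D_i}\nabla f_i(x;z)=\nabla f_i(x)$ and $\mathbb E_{z\sim\mathcal D_i}\|\nabla f_i(x;z)-\nabla f_i(x)\|^2\le\sigma^2$, where $\sigma\ge0$; 2. every $f_i$ is differentiable, and with a constant $L>0$, for all $x,y_1,\dots,y_n\in\mathbb R^d$, $\big\|\nabla f(x)-\frac1n\sum_{i}\nabla f_i(y_i)\big\|^2\le\frac{L^2}{n}\sum_{i}\|x-y_i\|^2$; 3. $f\ge f^*$ for some $f^*\in\mathbb R$; put $\Delta=f(x^0)-f^*$, where $x^0$ is the starting point. **Computation model.** Worker $i$ computes stochastic gradients one after another without pause, each in exactly $\tau_i>0$ seconds and with a fresh independent sample from $\mathcal D_i$; communication takes no time. Gradients that finish simultaneously may be processed in any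 order (fixed independently of the samples). Put $\tau_n=\max_i\tau_i$ (workers sorted by speed) and $\tau_{\rm avg}=\frac1n\sum_i\tau_i$. **Ringleader ASGD** with stepsize $\gamma$. All workers start at $x^0$; $k=0$, $S=\emptyset$, and $G_i=0$, $b_i=0$ for all $i$. The server repeats rounds of two phases. *Phase 1.* While $S\ne[n]$: receive a gradient $g$ from some worker $j$; set $G_j\leftarrow G_j+g$, $b_j\leftarrow b_j+1$, $S\leftarrow S\cup\{j\}$. *Phase 2.* Set $x^{k+1}=x^k-\gamma\frac1n\sum_i G_i/b_i$, send $x^{k+1}$ to the worker $j$ whose gradient ended Phase 1, and set $k\leftarrow k+1$, $S\leftarrow S\setminus\{j\}$; set $G_i^+=0$, $b_i^+=0$ for all $i$ and $S^+=\emptyset$. While $S\neq\emptyset$: receive a gradient $g$ from some worker $j$. If $j\in S$, set $G_j\leftarrow G_j+g$, $b_j\leftarrow b_j+1$, $x^{k+1}=x^k-\gamma\frac1n\sum_i G_i/b_i$, send $x^{k+1}$ to worker $j$, and set $k\leftarrow k+1$, $S\leftarrow S\setminus\{j\}$. Otherwise set $G_j^+\leftarrow G_j^++g$, $b_j^+\leftarrow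 b_j^++1$, $S^+\leftarrow S^+\cup\{j\}$. At the end of the phase set $G\leftarrow G^+$, $b\leftarrow b^+$, $S\leftarrow S^+$. Each worker always computes at the last point it was sent. Let $b_i^k$ be the value of $b_i$ used in the step from $x^k$ to $x^{k+1}$ (it depends only on the arrival order), $B^k=\big(\frac1n\sum_i 1/b_i^k\big)^{-1}$ and $B=\inf_{k\ge0}B^k$. **Theorem (Time Complexity).** There is a universal constant $C>0$ such that, under the assumptions above, for every $\varepsilon>0$ and with the stepsize $\gamma=\min\big\{\frac1{8nL},\frac{\varepsilon B}{10L\sigma^2}\big\}$ (the second term being $+\infty$ if $\sigma=0$), Ringleader ASGD finds an $\varepsilon$-stationary point within time $$T=C\,\frac{L\Delta}{\varepsilon}\Big(\tau_n+\tau_{\rm avg}\frac{\sigma^2}{n\varepsilon}\Big).$$ More precisely, for some $K\ge1$ the iterates $x^0,\dots,x^{K-1}$ are all available by time $T$ and $\frac1K\sum_{k<K}\mathbb E\|\nabla f(x^k)\|^2\le\varepsilon$; in particular $\mathbb E\|\nabla f(x^k)\|^2\le\varepsilon$ for some $k<K$. Moreover, let $L_f$ be the smallest Lipschitz constant of $\nabla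 f$. Whenever $L=O(L_f)$, this rate matches, up to a constant factor, the expression $\frac{L_f\Delta}{\varepsilon}\big(\tau_n+\tau_{\rm avg}\frac{\sigma^2}{n\varepsilon}\big)$ of the known lower bound of Tyurin and Richtárik for parallel stochastic first-order methods: $$\frac{L_f\Delta}{\varepsilon}\Big(\tau_n+\tau_{\rm avg}\frac{\sigma^2}{n\varepsilon}\Big)\le\frac{L\Delta}{\varepsilon}\Big(\tau_n+\tau_{\rm avg}\frac{\sigma^2}{n\varepsilon}\Big)\le C_0\,\frac{L_f\Delta}{\varepsilon}\Big(\tau_n+\tau_{\rm avg}\frac{\sigma^2}{n\varepsilon}\Big)\quad\text{whenever } L\le C_0L_f .$$ -/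

import Mathlib

open MeasureTheory ProbabilityTheory

universe u v

namespace Ringleader

noncomputable section

/-! ## The server: a step-by-step model of Ringleader ASGD -/

/-- `collect` is Phase 1 (await a gradient from every worker), `apply` is Phase 2 (one model update
for every worker). -/
inductive Phase where
  | collect
  | apply

/-- All variables of the algorithm: the iteration counter `k`, the current iterate `x`, the set `S`,
the gradient table `(G, b)`, the temporary table `(Gbuf, bbuf)` with its set `Sbuf`, and
for every worker the point at which it is currently computing gradients. -/
structure State (n : ℕ) (E : Type*) where
  phase : Phase
  k : ℕ
  x : E
  S : Finset (Fin n)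
  G : Fin n → E
  b : Fin n → ℕ
  Sbuf : Finset (Fin n)
  Gbuf : Fin n → E
  bbuf : Fin n → ℕ
  model : Fin n → E

/-- Add `a` to the `j`-th entry of a table. -/
def addAt {n : ℕ} {A : Type*} [Add A] (t : Fin n → A) (j : Fin n) (a : A) : Fin n → A :=
  Function.update t j (t j + a)

namespace State

variable {n : ℕ} {E : Type*} [AddCommGroup E] [Module ℝ E]

/-- The initial state: `x⁰` has been broadcast to all workers, the tables are empty. -/
def start (x₀ : E) : State n E where
  phase := .collect
  k := 0
  x := x₀
  S := ∅
  G := fun _ => 0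
  b := fun _ => 0
  Sbuf := ∅
  Gbuf := fun _ => 0
  bbuf := fun _ => 0
  model := fun _ => x₀

/-- Store the gradient `g` of worker `j` in the main table. -/
def store (s : State n E) (j : Fin n) (g : E) : State n E :=
  { s with G := addAt s.G j g, b := addAt s.b j 1 }

/-- Store the gradient `g` of worker `j` in the temporary table. -/
def buffer (s : State n E) (j : Fin n) (g : E) : State n E :=
  { s with Gbuf := addAt s.Gbuf j g, bbuf := addAt s.bbuf j 1, Sbuf := insert j s.Sbuf }

/-- The model step `xᵏ⁺¹ = xᵏ - γ (1/n) ∑ᵢ Gᵢ / bᵢ`. -/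
def nextIterate (γ : ℝ) (s : State n E) : E :=
  s.x - γ • ((1 / (n : ℝ)) • ∑ i, (1 / (s.b i : ℝ)) • s.G i)

/-- Make a model step, send the new iterate to worker `j` only, and remove `j` from `S`. -/
def updateFor (γ : ℝ) (s : State n E) (j : Fin n) : State n E :=
  { s with
    x := s.nextIterate γ
    model := Function.update s.model j (s.nextIterate γ)
    k := s.k + 1
    S := s.S.erase j }

/-- Enter Phase 2 with an empty temporary table. -/
def openPhaseTwo (s : State n E) : State n E :=
  { s with
    phase := .apply
    Sbuf := ∅
    Gbuf := fun _ => 0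
    bbuf := fun _ => 0 }

/-- As soon as `S = ∅`, Phase 2 is over: the temporary table becomes the main table
and Phase 1 of the next round begins. -/
def closeRound (s : State n E) : State n E :=
  if s.S = ∅ then { s with phase := .collect, S := s.Sbuf, G := s.Gbuf, b := s.bbuf } else s

/-- The reaction of the server to the arrival of the gradient `g` from worker `j`. -/
def receive (γ : ℝ) (s : State n E) (j : Fin n) (g : E) : State n E :=
  match s.phase with
  | .collect =>
      let s₁ := { s.store j g with S := insert j s.S }
      if s₁.S = Finset.univ then ((s₁.updateFor γ j).openPhaseTwo).closeRound else s₁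
  | .apply =>
      if j ∈ s.S then ((s.store j g).updateFor γ j).closeRound else s.buffer j g

end State

/-! ## The fixed computation model -/

/-- Worker `i` finishes its gradient number `l` (counted from `0`) at time `(l + 1) τᵢ`. -/
def finishTime {n : ℕ} (τ : Fin n → ℝ) (e : Fin n × ℕ) : ℝ := ((e.2 : ℝ) + 1) * τ e.1

/-- An order in which the gradients of all workers reach the server, compatible with the computation
times: arrival number `m` is gradient number `(toEquiv m).2` of worker `(toEquiv m).1`. The order
is determined by `τ`, except that simultaneous arrivals may be processed in any order. -/
structure ArrivalOrder (n : ℕ) (τ : Fin n → ℝ) where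
  toEquiv : ℕ ≃ Fin n × ℕ
  monotone_time : Monotone fun m => finishTime τ (toEquiv m)

/-- The time of the slowest worker, `τₙ = maxᵢ τᵢ`. -/
def slowest {n : ℕ} (τ : Fin n → ℝ) : ℝ := ⨆ i, τ i

/-- The average computation time. -/
def average {n : ℕ} (τ : Fin n → ℝ) : ℝ := (1 / (n : ℝ)) * ∑ i, τ i

section Run

variable {n : ℕ} {τ : Fin n → ℝ} (o : ArrivalOrder n τ)

/-- The state of the method after `m` arrivals. Here `g i l w` is the `l`-th stochastic
gradient of worker `i`, were it computed at the point `w`. -/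
def run {E : Type*} [AddCommGroup E] [Module ℝ E] (γ : ℝ) (x₀ : E) (g : Fin n → ℕ → E → E) :
    ℕ → State n E
  | 0 => State.start x₀
  | m + 1 =>
      let s := run γ x₀ g m
      let e := o.toEquiv m
      s.receive γ e.1 (g e.1 e.2 (s.model e.1))

/-- The bookkeeping part of the run (phase, counters, sets): the same method with all vectors
forgotten. It depends on the order of arrivals only, see `run_bookkeeping`. -/
def bookkeeping (m : ℕ) : State n PUnit.{1} :=
  run o 0 PUnit.unit (fun _ _ _ => PUnit.unit) m

/-- The number of arrivals after which the iterate `xᵏ` is available. -/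
def arrivalsUntil (k : ℕ) : ℕ := sInf {m | (bookkeeping o m).k = k}

/-- The time at which `m` arrivals have been processed. -/
def clock : ℕ → ℝ
  | 0 => 0
  | m + 1 => finishTime τ (o.toEquiv m)

/-- The time at which the iterate `xᵏ` is available. -/
def iterateTime (k : ℕ) : ℝ := clock o (arrivalsUntil o k)

/-- The numbers `bᵢᵏ`: how many gradients of worker `i` are averaged in the step
from `xᵏ` to `xᵏ⁺¹`, including the gradient that triggers this step. -/
def batch (k : ℕ) : Fin n → ℕ :=
  let m := arrivalsUntil o (k + 1) - 1
  addAt (bookkeeping o m).b (o.toEquiv m).1 1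

/-- `Bᵏ`, the harmonic mean of the batch sizes `bᵢᵏ`. -/
def harmonicBatch (k : ℕ) : ℝ := ((1 / (n : ℝ)) * ∑ i, 1 / (batch o k i : ℝ))⁻¹

/-- `B = inf_k Bᵏ`. -/
def minBatch : ℝ := ⨅ k, harmonicBatch o k

/-- The iterate `xᵏ`. -/
def iterate {E : Type*} [AddCommGroup E] [Module ℝ E] (γ : ℝ) (x₀ : E)
    (g : Fin n → ℕ → E → E) (k : ℕ) : E :=
  (run o γ x₀ g (arrivalsUntil o k)).x

/-- Forget all vectors of a state. -/
def State.forget {E : Type*} (s : State n E) : State n PUnit.{1} where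
  phase := s.phase
  k := s.k
  x := PUnit.unit
  S := s.S
  G := fun _ => PUnit.unit
  b := s.b
  Sbuf := s.Sbuf
  Gbuf := fun _ => PUnit.unit
  bbuf := s.bbuf
  model := fun _ => PUnit.unit

theorem State.forget_receive {E : Type*} [AddCommGroup E] [Module ℝ E] (γ γ₁ : ℝ)
    (s : State n E) (j : Fin n) (g : E) :
    (s.receive γ j g).forget = s.forget.receive γ₁ j PUnit.unit := by
  cases hs : s.phase <;>
    simp only [State.receive, State.forget, hs, State.store, State.updateFor,
      State.openPhaseTwo, State.closeRound, State.buffer] <;>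
    split_ifs <;> rfl

theorem run_bookkeeping {E : Type*} [AddCommGroup E] [Module ℝ E] (γ : ℝ) (x₀ : E)
    (g : Fin n → ℕ → E → E) (m : ℕ) : (run o γ x₀ g m).forget = bookkeeping o m := by
  induction m with
  | zero => rfl
  | succ m ih =>
    simp only [run, bookkeeping] at ih ⊢
    rw [State.forget_receive γ 0, ih]

end Run

/-! ## The optimization problem and the assumptions -/

/-- `ℝᵈ` with the Euclidean norm. -/
abbrev Vec (d : ℕ) : Type := EuclideanSpace ℝ (Fin d)

section Problem

variable {n d : ℕ} {Ξ : Fin n → Type u} [∀ i, MeasurableSpace (Ξ i)]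

/-- The local objective `fᵢ(x) = E_{z ∼ Dᵢ} Fᵢ(x; z)`. -/
def localObjective (D : ∀ i, Measure (Ξ i)) (F : ∀ i, Vec d → Ξ i → ℝ) (i : Fin n) (x : Vec d) : ℝ :=
  ∫ z, F i x z ∂(D i)

/-- The objective `f = (1/n) ∑ᵢ fᵢ`. -/
def objective (D : ∀ i, Measure (Ξ i)) (F : ∀ i, Vec d → Ξ i → ℝ) (x : Vec d) : ℝ :=
  (1 / (n : ℝ)) * ∑ i, localObjective D F i x

/-- The stochastic gradient `∇Fᵢ(x; z)` with respect to `x`. -/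
def sampleGradient (F : ∀ i, Vec d → Ξ i → ℝ) (i : Fin n) (z : Ξ i) (x : Vec d) : Vec d :=
  gradient (fun y => F i y z) x

/-- The sample losses are measurable and integrable in the data point and differentiable in `x`, and
the stochastic gradients are unbiased with variance at most `σ²`. -/
structure BoundedVariance (D : ∀ i, Measure (Ξ i)) (F : ∀ i, Vec d → Ξ i → ℝ) (σ : ℝ) : Prop where
  measurable : ∀ i x, Measurable (F i x)
  integrable : ∀ i x, Integrable (F i x) (D i)
  differentiable : ∀ i z, Differentiable ℝ fun x => F i x z
  integrable_gradient : ∀ i x, Integrable (fun z => sampleGradient F i z x) (D i)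
  unbiased : ∀ i x, ∫ z, sampleGradient F i z x ∂(D i) = gradient (localObjective D F i) x
  integrable_sq : ∀ i x,
    Integrable (fun z => ‖sampleGradient F i z x - gradient (localObjective D F i) x‖ ^ 2) (D i)
  variance_le : ∀ i x,
    ∫ z, ‖sampleGradient F i z x - gradient (localObjective D F i) x‖ ^ 2 ∂(D i) ≤ σ ^ 2

/-- The averaged smoothness-type assumption with constant `L`. -/
structure AveragedSmooth (D : ∀ i, Measure (Ξ i)) (F : ∀ i, Vec d → Ξ i → ℝ) (L : ℝ) : Prop where
  pos : 0 < L
  differentiable : ∀ i, Differentiable ℝ (localObjective D F i)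
  bound : ∀ (x : Vec d) (y : Fin n → Vec d),
    ‖gradient (objective D F) x - (1 / (n : ℝ)) • ∑ i, gradient (localObjective D F i) (y i)‖ ^ 2
      ≤ L ^ 2 / n * ∑ i, ‖x - y i‖ ^ 2

/-- The data points: `ξ i l` is used by worker `i` for its `l`-th gradient and has law `Dᵢ`, and
all data points are independent. -/
structure IndepSamples (D : ∀ i, Measure (Ξ i)) {Ω : Type v} [MeasurableSpace Ω] (P : Measure Ω)
    (ξ : ∀ i : Fin n, ℕ → Ω → Ξ i) : Prop where
  measurable : ∀ i l, Measurable (ξ i l)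
  law : ∀ i l, P.map (ξ i l) = D i
  indep : iIndepFun (fun p : (_ : Fin n) × ℕ => ξ p.1 p.2) P

/-- The random iterate `xᵏ` of Ringleader ASGD. -/
def ringleader {τ : Fin n → ℝ} (o : ArrivalOrder n τ) (F : ∀ i, Vec d → Ξ i → ℝ) {Ω : Type v}
    (ξ : ∀ i : Fin n, ℕ → Ω → Ξ i) (γ : ℝ) (x₀ : Vec d) (k : ℕ) (ω : Ω) : Vec d :=
  iterate o γ x₀ (fun i l w => sampleGradient F i (ξ i l ω) w) k

end Problem

/-- The smoothness constant of `φ`: the smallest Lipschitz constant of its gradient. -/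
def smoothnessConstant {d : ℕ} (φ : Vec d → ℝ) : ℝ :=
  sInf {M : ℝ | 0 ≤ M ∧ ∀ x y, ‖gradient φ x - gradient φ y‖ ≤ M * ‖x - y‖}

/-- The random vector `X` is an `ε`-stationary point of `φ`. -/
def IsStationary {d : ℕ} {Ω : Type v} [MeasurableSpace Ω] (P : Measure Ω) (φ : Vec d → ℝ) (ε : ℝ)
    (X : Ω → Vec d) : Prop :=
  Integrable (fun ω => ‖gradient φ (X ω)‖ ^ 2) P ∧ ∫ ω, ‖gradient φ (X ω)‖ ^ 2 ∂P ≤ ε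

/-- The stepsize `min {1 / (8nL), εB / (10Lσ²)}`; for `σ = 0` the second term is `+∞`. -/
def stepsize (n : ℕ) (L ε σ B : ℝ) : ℝ :=
  if σ = 0 then 1 / (8 * n * L) else min (1 / (8 * n * L)) (ε * B / (10 * L * σ ^ 2))

/-- The expression `(MΔ/ε) (τₙ + τ_avg σ² / (nε))`. -/
def rate {n : ℕ} (τ : Fin n → ℝ) (M Δ ε σ : ℝ) : ℝ :=
  M * Δ / ε * (slowest τ + average τ * (σ ^ 2 / (n * ε)))

end

end Ringleader

/-! The arrival order alone fixes a round structure. Round r consists of the n steps from x^{rn} to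
x^{(r+1)n}, one step for each worker, and its table holds the gradients of worker i that arrive
after its r-th update, up to and including the one that triggers its next update. `run_step` carries
this invariant. All steps of a round therefore use the same stale points, none of them later than
x^{rn}.

Time. In each phase some worker is silent until the arrival that ends the phase, so a phase lasts at
most τ_n and a round at most 2τ_n (`iterateTime_le`). Conversely, the first updates of consecutive
rounds are at least τ_n apart, so worker i contributes at least τ_n/τ_i - 2 gradients to a table,
and at least one. Hence 1/b_i ≤ 3τ_i/τ_n, and averaging gives τ_n/B ≤ 3τ_avg (`batch_ge`,
`minBatch_ge`).

Convergence. A step moves along M + N, where M is the mean of the local gradients at the stale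
points and the noise N has second moment at most σ²/(nB). Steps of one round share samples, so N is
not centered given x^k. It is centered given everything before the round; so ∇f(x^k) is compared
with ∇f(W), where W is the point that noiseless steps of this round would have reached
(`exists_noiseless`). The difference is of second order in γ. Staleness spans at most two rounds, so
the error of M is controlled by E‖M‖² of the current and the previous round and by the noise
(`integral_gradient_sub_mean_sq`). For γ ≤ 1/(8nL) the descent term -(γ/2)E‖M‖² pays for both, and
the rest telescopes over rounds (`integral_objective_rounds`).

The mean squared gradient is thus at most 2Δ/(γK) + (5/2)γLσ²/B. The stepsize makes this at most ε
after R rounds, and in the time 2τ_n R the factor τ_n/B turns into 3τ_avg (`exists_rounds`). The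
comparison with the lower bound holds because the rate is linear in the smoothness constant and L_f
≤ L. -/

namespace Ringleader

noncomputable section

/-! ### Rounds, tables, and the invariant of the two phases -/

section Bookkeeping

variable {n : ℕ} {τ : Fin n → ℝ} (o : ArrivalOrder n τ)

/-- The worker whose gradient is arrival number `m`. -/
def worker (m : ℕ) : Fin n := (o.toEquiv m).1

/-- The iteration counter after `m` arrivals. -/
def counter (m : ℕ) : ℕ := (bookkeeping o m).k

/-- The number of model updates that worker `i` has received during the first `m` arrivals. -/
def updates : ℕ → Fin n → ℕ
  | 0 => fun _ => 0
  | m + 1 => fun i =>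
      updates m i + if worker o m = i ∧ counter o (m + 1) ≠ counter o m then 1 else 0

/-- Those of the first `m` arrivals that come from worker `i` and belong to the gradient table of
round `ρ`. -/
def arrivals (m ρ : ℕ) (i : Fin n) : Finset ℕ :=
  (Finset.range m).filter fun a => worker o a = i ∧ updates o a i = ρ

variable {o}

theorem mem_arrivals {m ρ : ℕ} {i : Fin n} {a : ℕ} :
    a ∈ arrivals o m ρ i ↔ a < m ∧ worker o a = i ∧ updates o a i = ρ := by
  simp [arrivals]

theorem updates_mono (i : Fin n) : Monotone fun m => updates o m i :=
  monotone_nat_of_le_succ fun m => by simp [updates]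

theorem arrivals_mono {m m' : ℕ} (h : m ≤ m') (ρ : ℕ) (i : Fin n) :
    arrivals o m ρ i ⊆ arrivals o m' ρ i := fun a ha => by
  rw [mem_arrivals] at ha ⊢
  exact ⟨ha.1.trans_le h, ha.2⟩

theorem arrivals_succ_worker {m ρ : ℕ} (h : updates o m (worker o m) = ρ) :
    arrivals o (m + 1) ρ (worker o m) = insert m (arrivals o m ρ (worker o m)) := by
  ext a
  simp only [mem_arrivals, Finset.mem_insert]
  constructor
  · rintro ⟨h1, h2⟩
    rcases Nat.lt_succ_iff_lt_or_eq.1 h1 with h3 | h3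
    · exact Or.inr ⟨h3, h2⟩
    · exact Or.inl h3
  · rintro (rfl | h1)
    · exact ⟨Nat.lt_succ_self _, rfl, h⟩
    · exact ⟨h1.1.trans (Nat.lt_succ_self _), h1.2⟩

theorem arrivals_succ_of_ne {m ρ : ℕ} {i : Fin n}
    (h : ¬ (worker o m = i ∧ updates o m i = ρ)) :
    arrivals o (m + 1) ρ i = arrivals o m ρ i := by
  ext a
  simp only [mem_arrivals]
  constructor
  · rintro ⟨h1, h2⟩
    rcases Nat.lt_succ_iff_lt_or_eq.1 h1 with h3 | h3
    · exact ⟨h3, h2⟩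
    · subst h3; exact absurd h2 h
  · rintro h1
    exact ⟨h1.1.trans (Nat.lt_succ_self _), h1.2⟩

theorem not_mem_arrivals_self (m ρ : ℕ) (i : Fin n) : m ∉ arrivals o m ρ i := by
  simp [mem_arrivals]

/-- After `m` arrivals, `(b, G)` is the table of the gradients of round `ρ`, and `S` is the set of
workers represented in it. The vector `v a` is the gradient of arrival `a`. -/
structure IsTable (o : ArrivalOrder n τ) {E : Type*} [AddCommGroup E] (v : ℕ → E) (m ρ : ℕ)
    (S : Finset (Fin n)) (b : Fin n → ℕ) (G : Fin n → E) : Prop where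
  mem_iff : ∀ i, i ∈ S ↔ (arrivals o m ρ i).Nonempty
  count : ∀ i, b i = (arrivals o m ρ i).card
  sum : ∀ i, G i = ∑ a ∈ arrivals o m ρ i, v a

section Table

variable {E : Type*} [AddCommGroup E] {v : ℕ → E} {m ρ : ℕ} {S : Finset (Fin n)}
  {b : Fin n → ℕ} {G : Fin n → E}

/-- Membership in a table is decided by the number of updates before the arrival, so the gradient
that triggers an update still counts for the round being served. -/
theorem IsTable.arrive (h : IsTable o v m ρ S b G) (hρ : updates o m (worker o m) = ρ) :
    IsTable o v (m + 1) ρ (insert (worker o m) S) (addAt b (worker o m) 1)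
      (addAt G (worker o m) (v m)) := by
  refine ⟨fun i => ?_, fun i => ?_, fun i => ?_⟩ <;> by_cases hi : i = worker o m
  · subst hi; simp [arrivals_succ_worker hρ]
  · rw [arrivals_succ_of_ne fun h => hi h.1.symm, ← h.mem_iff]; simp [hi]
  · subst hi
    simp [arrivals_succ_worker hρ, addAt, Finset.card_insert_of_notMem (not_mem_arrivals_self _ _ _),
      h.count]
  · rw [arrivals_succ_of_ne fun h => hi h.1.symm, ← h.count]; simp [hi, addAt]
  · subst hi
    simp [arrivals_succ_worker hρ, addAt, Finset.sum_insert (not_mem_arrivals_self _ _ _), h.sum,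
      add_comm]
  · rw [arrivals_succ_of_ne fun h => hi h.1.symm, ← h.sum]; simp [hi, addAt]

theorem IsTable.skip (h : IsTable o v m ρ S b G) (hρ : updates o m (worker o m) ≠ ρ) :
    IsTable o v (m + 1) ρ S b G := by
  have key : ∀ i, arrivals o (m + 1) ρ i = arrivals o m ρ i := fun i =>
    arrivals_succ_of_ne (by rintro ⟨rfl, h2⟩; exact hρ h2)
  exact ⟨fun i => by rw [key, h.mem_iff], fun i => by rw [key, h.count], fun i => by
    rw [key, h.sum]⟩

theorem isTable_empty (h : ∀ a < m, updates o a (worker o a) < ρ) :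
    IsTable o v m ρ ∅ (fun _ => 0) (fun _ => 0) := by
  have key : ∀ i, arrivals o m ρ i = ∅ := fun i => by
    ext a
    simp only [mem_arrivals, Finset.notMem_empty, iff_false]
    rintro ⟨h1, rfl, h3⟩
    exact (h a h1).ne h3
  exact ⟨fun i => by simp [key], fun i => by simp [key], fun i => by simp [key]⟩

end Table

/-- After `m` arrivals, the state `s` is in Phase 1 of round `r`. -/
structure Collecting (o : ArrivalOrder n τ) {E : Type*} [AddCommGroup E] (v : ℕ → E) (m r : ℕ)
    (s : State n E) : Prop where
  phase : s.phase = .collect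
  k : s.k = r * n
  updates_eq : ∀ i, updates o m i = r
  ne_univ : s.S ≠ Finset.univ
  table : IsTable o v m r s.S s.b s.G

/-- After `m` arrivals, the state `s` is in Phase 2 of round `r`. -/
structure Applying (o : ArrivalOrder n τ) {E : Type*} [AddCommGroup E] (v : ℕ → E) (m r : ℕ)
    (s : State n E) : Prop where
  phase : s.phase = .apply
  nonempty : s.S.Nonempty
  ne_univ : s.S ≠ Finset.univ
  k : s.k + s.S.card = (r + 1) * n
  updates_eq : ∀ i, updates o m i = if i ∈ s.S then r else r + 1
  table : IsTable o v m r Finset.univ s.b s.G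
  buffer : IsTable o v m (r + 1) s.Sbuf s.bbuf s.Gbuf

/-- After `m` arrivals, the state `s` is in round `r`. -/
def InRound (o : ArrivalOrder n τ) {E : Type*} [AddCommGroup E] (v : ℕ → E) (m r : ℕ)
    (s : State n E) : Prop :=
  Collecting o v m r s ∨ Applying o v m r s

section Step

variable {E : Type*} [AddCommGroup E] {v : ℕ → E} {m r : ℕ} {s : State n E}

/-- Phase 1 sits at a multiple of n. In Phase 2 the set `S` is neither empty nor full, so k lies
strictly between two consecutive multiples. -/
theorem InRound.k_div (h : InRound o v m r s) : s.k / n = r := by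
  rcases h with h | h
  · rw [h.k]
    exact Nat.mul_div_cancel _ (Nat.pos_of_ne_zero fun hn => by
      subst hn; exact h.ne_univ (Subsingleton.elim _ _))
  · have h1 := h.nonempty.card_pos
    have h2 := (Finset.card_lt_univ_of_notMem
      (Classical.not_forall.1 fun hu => h.ne_univ (Finset.eq_univ_iff_forall.2 hu)).choose_spec)
    rw [Fintype.card_fin] at h2
    have h3 := h.k
    rw [Nat.add_mul] at h3
    exact Nat.div_eq_of_lt_le (by omega) (by rw [Nat.add_mul]; omega)

theorem InRound.updates_le (h : InRound o v m r s) (i : Fin n) : updates o m i ≤ r + 1 := by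
  rcases h with h | h
  · rw [h.updates_eq]; omega
  · rw [h.updates_eq]; split_ifs <;> omega

theorem InRound.le_updates (h : InRound o v m r s) (i : Fin n) : r ≤ updates o m i := by
  rcases h with h | h
  · rw [h.updates_eq]
  · rw [h.updates_eq]; split_ifs <;> omega

theorem InRound.exists_table (h : InRound o v m r s) : ∃ S, IsTable o v m r S s.b s.G := by
  rcases h with h | h
  · exact ⟨_, h.table⟩
  · exact ⟨_, h.table⟩

variable [Module ℝ E] {γ : ℝ}

/-- The effect of an arrival that does not trigger a model update. -/
structure Stays (o : ArrivalOrder n τ) (v : ℕ → E) (m r : ℕ) (s s' : State n E) : Prop where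
  k : s'.k = s.k
  x : s'.x = s.x
  model : s'.model = s.model
  inRound : InRound o v (m + 1) r s'

/-- The effect of an arrival that triggers a model update. -/
structure Moves (o : ArrivalOrder n τ) (v : ℕ → E) (γ : ℝ) (m r : ℕ) (s s' : State n E) :
    Prop where
  k : s'.k = s.k + 1
  x : s'.x = (s.store (worker o m) (v m)).nextIterate γ
  model : s'.model = Function.update s.model (worker o m) s'.x
  updates_eq : updates o m (worker o m) = r
  full : ∀ i, (arrivals o (m + 1) r i).Nonempty
  inRound : InRound o v (m + 1) r s' ∨ Collecting o v (m + 1) (r + 1) s'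

theorem updates_succ_of_eq (h : counter o (m + 1) = counter o m) (i : Fin n) :
    updates o (m + 1) i = updates o m i := by
  simp [updates, h]

theorem updates_succ_of_ne (h : counter o (m + 1) ≠ counter o m) (i : Fin n) :
    updates o (m + 1) i = updates o m i + if worker o m = i then 1 else 0 := by
  simp [updates, h]

theorem Collecting.receive (h : Collecting o v m r s) (hk : counter o m = s.k)
    (hk' : counter o (m + 1) = (s.receive γ (worker o m) (v m)).k) :
    Stays o v m r s (s.receive γ (worker o m) (v m)) ∨
      Moves o v γ m r s (s.receive γ (worker o m) (v m)) := by
  have ht := h.table.arrive (h.updates_eq _)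
  by_cases hS : insert (worker o m) s.S = Finset.univ
  · right
    -- Only for n = 1 is nobody left to serve after the first update; the round then closes at once.
    by_cases hn : Finset.univ.erase (worker o m) = ∅
    · have hs : s.receive γ (worker o m) (v m) =
        { phase := .collect, k := s.k + 1, x := (s.store (worker o m) (v m)).nextIterate γ,
          S := ∅, G := fun _ => 0, b := fun _ => 0, Sbuf := ∅, Gbuf := fun _ => 0,
          bbuf := fun _ => 0,
          model := Function.update s.model (worker o m)
            ((s.store (worker o m) (v m)).nextIterate γ) } := by
        simp [State.receive, h.phase, State.store, hS, State.updateFor, State.openPhaseTwo,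
          State.closeRound, hn, State.nextIterate]
      rw [hs] at hk' ⊢
      have hne : counter o (m + 1) ≠ counter o m := by rw [hk', hk]; simp
      have hw : ∀ i, i = worker o m := fun i => by
        by_contra hi
        have : i ∈ Finset.univ.erase (worker o m) := by simp [hi]
        rw [hn] at this
        simp at this
      have hn1 : n = 1 := by
        have := Fintype.card_eq_one_iff.2 ⟨worker o m, hw⟩
        simpa using this
      have hu : ∀ i, updates o (m + 1) i = r + 1 := fun i => by
        rw [updates_succ_of_ne hne, if_pos (hw i).symm, h.updates_eq]
      refine ⟨rfl, rfl, rfl, h.updates_eq _, fun i => ?_, Or.inr ⟨rfl, ?_, hu, ?_, ?_⟩⟩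
      · rw [← ht.mem_iff, hS]; exact Finset.mem_univ _
      · simp [h.k, hn1]
      · intro he
        have := Finset.mem_univ (worker o m)
        simp [← he] at this
      · refine isTable_empty fun a ha => ?_
        have := updates_mono (o := o) (worker o a) (Nat.lt_succ_iff.1 ha)
        simp only [h.updates_eq] at this
        omega
    · have hs : s.receive γ (worker o m) (v m) =
        { phase := .apply, k := s.k + 1, x := (s.store (worker o m) (v m)).nextIterate γ,
          S := Finset.univ.erase (worker o m), G := addAt s.G (worker o m) (v m),
          b := addAt s.b (worker o m) 1, Sbuf := ∅, Gbuf := fun _ => 0,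
          bbuf := fun _ => 0,
          model := Function.update s.model (worker o m)
            ((s.store (worker o m) (v m)).nextIterate γ) } := by
        simp [State.receive, h.phase, State.store, hS, State.updateFor, State.openPhaseTwo,
          State.closeRound, hn, State.nextIterate]
      rw [hs] at hk' ⊢
      have hne : counter o (m + 1) ≠ counter o m := by rw [hk', hk]; simp
      refine ⟨rfl, rfl, rfl, h.updates_eq _, fun i => ?_,
        Or.inl (Or.inr ⟨rfl, Finset.nonempty_iff_ne_empty.2 hn, ?_, ?_, ?_, ?_, ?_⟩)⟩
      · rw [← ht.mem_iff, hS]; exact Finset.mem_univ _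
      · intro he
        have := Finset.mem_univ (worker o m)
        rw [← he] at this
        simp at this
      · have hpos : 0 < n := (worker o m).pos
        simp only [h.k, Finset.card_erase_of_mem (Finset.mem_univ _), Finset.card_univ,
          Fintype.card_fin, Nat.add_mul]
        omega
      · intro i
        rw [updates_succ_of_ne hne, h.updates_eq]
        by_cases hi : i = worker o m
        · simp [hi]
        · simp [hi, Ne.symm hi]
      · rw [← hS]; exact ht
      · refine isTable_empty fun a ha => ?_
        have := updates_mono (o := o) (worker o a) (Nat.lt_succ_iff.1 ha)
        simp only [h.updates_eq] at this
        omega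
  · left
    have hs : s.receive γ (worker o m) (v m) =
        { s.store (worker o m) (v m) with S := insert (worker o m) s.S } := by
      simp [State.receive, h.phase, State.store, hS]
    rw [hs] at hk' ⊢
    have he : counter o (m + 1) = counter o m := by rw [hk', hk]; rfl
    exact ⟨rfl, rfl, rfl, Or.inl ⟨h.phase, h.k,
      fun i => by rw [updates_succ_of_eq he, h.updates_eq], hS, ht⟩⟩

theorem Applying.receive_of_mem (h : Applying o v m r s) (hk : counter o m = s.k)
    (hk' : counter o (m + 1) = (s.receive γ (worker o m) (v m)).k) (hS : worker o m ∈ s.S) :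
    Moves o v γ m r s (s.receive γ (worker o m) (v m)) := by
  have hu : updates o m (worker o m) = r := by rw [h.updates_eq, if_pos hS]
  have ht := h.table.arrive hu
  have hb := h.buffer.skip (by rw [hu]; omega)
  have hfull : ∀ i, (arrivals o (m + 1) r i).Nonempty := fun i => by
    rw [← ht.mem_iff]; simp
  by_cases hn : s.S.erase (worker o m) = ∅
  · have hs : s.receive γ (worker o m) (v m) =
      { phase := .collect, k := s.k + 1, x := (s.store (worker o m) (v m)).nextIterate γ,
        S := s.Sbuf, G := s.Gbuf, b := s.bbuf, Sbuf := s.Sbuf, Gbuf := s.Gbuf, bbuf := s.bbuf,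
        model := Function.update s.model (worker o m)
          ((s.store (worker o m) (v m)).nextIterate γ) } := by
      simp [State.receive, h.phase, State.store, hS, State.updateFor,
        State.closeRound, hn, State.nextIterate]
    rw [hs] at hk' ⊢
    have hne : counter o (m + 1) ≠ counter o m := by rw [hk', hk]; simp
    refine ⟨rfl, rfl, rfl, hu, hfull, Or.inr ⟨rfl, ?_, ?_, ?_, hb⟩⟩
    · have h1 := h.k
      have h2 := Finset.card_erase_of_mem hS
      have h3 := Finset.card_pos.2 ⟨_, hS⟩
      rw [hn, Finset.card_empty] at h2
      simp only
      omega
    · intro i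
      rw [updates_succ_of_ne hne, h.updates_eq]
      by_cases hi : i = worker o m
      · subst hi; simp [hS]
      · have hi' : i ∉ s.S := fun hm => by
          have : i ∈ s.S.erase (worker o m) := by simp [hi, hm]
          rw [hn] at this
          simp at this
        simp [Ne.symm hi, hi']
    -- The worker served last cannot be in the buffer: it had r updates until now, and a buffered
    -- gradient requires r + 1. So the next Phase 1 starts with somebody missing.
    · intro he
      have h1 : worker o m ∈ s.Sbuf := by
        simp only at he
        rw [he]; exact Finset.mem_univ _
      obtain ⟨a, ha⟩ := (h.buffer.mem_iff _).1 h1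
      obtain ⟨h2, -, h3⟩ := mem_arrivals.1 ha
      have := updates_mono (o := o) (worker o m) h2.le
      simp only at this
      omega
  · have hs : s.receive γ (worker o m) (v m) =
      { s.store (worker o m) (v m) with
        k := s.k + 1, x := (s.store (worker o m) (v m)).nextIterate γ,
        S := s.S.erase (worker o m),
        model := Function.update s.model (worker o m)
          ((s.store (worker o m) (v m)).nextIterate γ) } := by
      simp [State.receive, h.phase, State.store, hS, State.updateFor,
        State.closeRound, hn, State.nextIterate]
    rw [hs] at hk' ⊢
    have hne : counter o (m + 1) ≠ counter o m := by rw [hk', hk]; simp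
    refine ⟨rfl, rfl, rfl, hu, hfull, Or.inl (Or.inr ⟨h.phase,
      Finset.nonempty_iff_ne_empty.2 hn, ?_, ?_, ?_,
      by rwa [Finset.insert_eq_of_mem (Finset.mem_univ _)] at ht, hb⟩)⟩
    · intro he
      have := Finset.mem_univ (worker o m)
      rw [← he] at this
      simp at this
    · have h1 := h.k
      have h2 := Finset.card_erase_of_mem hS
      have h3 := Finset.card_pos.2 ⟨_, hS⟩
      simp only
      omega
    · intro i
      rw [updates_succ_of_ne hne, h.updates_eq]
      by_cases hi : i = worker o m
      · subst hi; simp [hS]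
      · simp [hi, Ne.symm hi]

theorem Applying.receive_of_not_mem (h : Applying o v m r s) (hk : counter o m = s.k)
    (hk' : counter o (m + 1) = (s.receive γ (worker o m) (v m)).k) (hS : worker o m ∉ s.S) :
    Stays o v m r s (s.receive γ (worker o m) (v m)) := by
  have hu : updates o m (worker o m) = r + 1 := by rw [h.updates_eq, if_neg hS]
  have hs : s.receive γ (worker o m) (v m) = s.buffer (worker o m) (v m) := by
    simp [State.receive, h.phase, hS]
  rw [hs] at hk' ⊢
  have he : counter o (m + 1) = counter o m := by rw [hk', hk]; rfl
  exact ⟨rfl, rfl, rfl, Or.inr ⟨h.phase, h.nonempty, h.ne_univ, h.k,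
    fun i => by rw [updates_succ_of_eq he, h.updates_eq]; rfl,
    h.table.skip (by rw [hu]; omega), h.buffer.arrive hu⟩⟩

theorem InRound.receive (h : InRound o v m r s) (hk : counter o m = s.k)
    (hk' : counter o (m + 1) = (s.receive γ (worker o m) (v m)).k) :
    Stays o v m r s (s.receive γ (worker o m) (v m)) ∨
      Moves o v γ m r s (s.receive γ (worker o m) (v m)) := by
  rcases h with h | h
  · exact h.receive hk hk'
  · by_cases hS : worker o m ∈ s.S
    · exact Or.inr (h.receive_of_mem hk hk' hS)
    · exact Or.inl (h.receive_of_not_mem hk hk' hS)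

end Step

end Bookkeeping

/-! ### The iteration counter as a clock for rounds and phases; silent workers -/

section Counter

variable {n : ℕ} {τ : Fin n → ℝ} (o : ArrivalOrder n τ)

/-- The gradient that is arrival number `m`. -/
def received {E : Type*} [AddCommGroup E] [Module ℝ E] (γ : ℝ) (x₀ : E) (g : Fin n → ℕ → E → E)
    (m : ℕ) : E :=
  g (o.toEquiv m).1 (o.toEquiv m).2 ((run o γ x₀ g m).model (worker o m))

variable {o}

theorem card_pos (o : ArrivalOrder n τ) : 0 < n := (worker o 0).pos

section Run

variable {E : Type*} [AddCommGroup E] [Module ℝ E] (γ : ℝ) (x₀ : E) (g : Fin n → ℕ → E → E)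

theorem run_k (m : ℕ) : (run o γ x₀ g m).k = counter o m := by
  rw [counter, ← run_bookkeeping o γ x₀ g m]; rfl

theorem run_succ (m : ℕ) : run o γ x₀ g (m + 1) =
    (run o γ x₀ g m).receive γ (worker o m) (received o γ x₀ g m) := rfl

theorem exists_inRound (m : ℕ) :
    ∃ r, InRound o (received o γ x₀ g) m r (run o γ x₀ g m) := by
  induction m with
  | zero =>
    refine ⟨0, Or.inl ⟨rfl, by simp [run, State.start], fun i => rfl, ?_,
      isTable_empty (by simp)⟩⟩
    intro h
    have := Finset.mem_univ (worker o 0)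
    simp [← h, run, State.start] at this
  | succ m ih =>
    obtain ⟨r, ih⟩ := ih
    rw [run_succ]
    rcases ih.receive (γ := γ) (run_k γ x₀ g m).symm
      (by rw [← run_succ]; exact (run_k γ x₀ g (m + 1)).symm) with h | h
    · exact ⟨r, h.inRound⟩
    · rcases h.inRound with h | h
      · exact ⟨r, h⟩
      · exact ⟨r + 1, Or.inl h⟩

theorem inRound_run (m : ℕ) :
    InRound o (received o γ x₀ g) m (counter o m / n) (run o γ x₀ g m) := by
  obtain ⟨r, h⟩ := exists_inRound (o := o) γ x₀ g m
  rw [← run_k γ x₀ g m, h.k_div]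
  exact h

theorem run_step (m : ℕ) :
    Stays o (received o γ x₀ g) m (counter o m / n) (run o γ x₀ g m) (run o γ x₀ g (m + 1)) ∨
    Moves o (received o γ x₀ g) γ m (counter o m / n) (run o γ x₀ g m)
      (run o γ x₀ g (m + 1)) :=
  (inRound_run γ x₀ g m).receive (run_k γ x₀ g m).symm (run_k γ x₀ g (m + 1)).symm

theorem run_moves {m : ℕ} (h : counter o (m + 1) ≠ counter o m) :
    Moves o (received o γ x₀ g) γ m (counter o m / n) (run o γ x₀ g m)
      (run o γ x₀ g (m + 1)) := by
  rcases run_step (o := o) γ x₀ g m with h1 | h1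
  · exact absurd (by rw [← run_k γ x₀ g, ← run_k γ x₀ g, h1.k]) h
  · exact h1

theorem run_stays {m : ℕ} (h : counter o (m + 1) = counter o m) :
    Stays o (received o γ x₀ g) m (counter o m / n) (run o γ x₀ g m)
      (run o γ x₀ g (m + 1)) := by
  rcases run_step (o := o) γ x₀ g m with h1 | h1
  · exact h1
  · have h2 := h1.k
    rw [run_k, run_k] at h2
    omega

end Run

/-- The vectors received in the bookkeeping part of the run. -/
abbrev noVectors : ℕ → PUnit.{1} := fun _ => PUnit.unit

theorem inRound_bookkeeping (o : ArrivalOrder n τ) (m : ℕ) :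
    InRound o noVectors m (counter o m / n) (bookkeeping o m) :=
  inRound_run 0 PUnit.unit (fun _ _ _ => PUnit.unit) m

theorem bookkeeping_moves {m : ℕ} (h : counter o (m + 1) ≠ counter o m) :
    Moves o noVectors 0 m (counter o m / n) (bookkeeping o m) (bookkeeping o (m + 1)) :=
  run_moves 0 PUnit.unit (fun _ _ _ => PUnit.unit) h

theorem counter_zero : counter o 0 = 0 := rfl

theorem counter_succ_of_ne {m : ℕ} (h : counter o (m + 1) ≠ counter o m) :
    counter o (m + 1) = counter o m + 1 :=
  (bookkeeping_moves h).k

theorem counter_mono (o : ArrivalOrder n τ) : Monotone (counter o) :=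
  monotone_nat_of_le_succ fun m => by
    by_cases h : counter o (m + 1) = counter o m
    · exact h.ge
    · rw [counter_succ_of_ne h]; exact Nat.le_succ _

theorem collecting_of_counter_eq {m r : ℕ} (h : counter o m = r * n) :
    Collecting o noVectors m r (bookkeeping o m) := by
  have hr := inRound_bookkeeping o m
  rw [h, Nat.mul_div_cancel _ (card_pos o)] at hr
  rcases hr with hr | hr
  · exact hr
  · have h1 : (bookkeeping o m).S.card < n := by
      have := Finset.card_lt_univ_of_notMem
        (Classical.not_forall.1 fun hu => hr.ne_univ (Finset.eq_univ_iff_forall.2 hu)).choose_spec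
      rwa [Fintype.card_fin] at this
    have h2 := hr.k
    have h3 : (bookkeeping o m).k = r * n := h
    rw [h3, Nat.add_mul] at h2
    omega

theorem applying_of_counter_lt {m r : ℕ} (h : r * n < counter o m)
    (h' : counter o m < (r + 1) * n) : Applying o noVectors m r (bookkeeping o m) := by
  have hr := inRound_bookkeeping o m
  have hd : counter o m / n = r := Nat.div_eq_of_lt_le h.le h'
  rw [hd] at hr
  rcases hr with hr | hr
  · exact absurd hr.k h.ne'
  · exact hr

theorem counter_succ_of_applying {m r : ℕ} (h : Applying o noVectors m r (bookkeeping o m))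
    (hS : worker o m ∈ (bookkeeping o m).S) : counter o (m + 1) ≠ counter o m := by
  have h2 : counter o (m + 1) = counter o m + 1 :=
    (h.receive_of_mem (γ := 0) rfl rfl hS).k
  omega

/-- Whoever reports during Phase 2 is either pending, and served now, or has been served already. -/
theorem updates_succ_of_applying {m r : ℕ} (h : Applying o noVectors m r (bookkeeping o m)) :
    updates o (m + 1) (worker o m) = r + 1 := by
  by_cases hS : worker o m ∈ (bookkeeping o m).S
  · rw [updates_succ_of_ne (counter_succ_of_applying h hS), h.updates_eq]
    simp [hS]
  · have h1 := updates_mono (o := o) (worker o m) (Nat.le_succ m)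
    simp only [h.updates_eq, hS, if_false] at h1
    refine le_antisymm ?_ h1
    rcases h.receive_of_not_mem (γ := 0) rfl rfl hS with ⟨-, -, -, hr⟩
    exact hr.updates_le _

/-- Phase 1 is still on at `m` because somebody is missing from `S`; any gradient of that worker
since `a` would have put it there. -/
theorem exists_idle_of_counter_eq {a m r : ℕ} (ha : counter o a = r * n)
    (hm : counter o m = r * n) : ∃ i, ∀ c, a ≤ c → c < m → worker o c ≠ i := by
  have h := collecting_of_counter_eq hm
  obtain ⟨i, hi⟩ := Classical.not_forall.1 fun hu => h.ne_univ (Finset.eq_univ_iff_forall.2 hu)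
  refine ⟨i, fun c hac hcm hw => hi ((h.table.mem_iff i).2 ⟨c, mem_arrivals.2 ⟨hcm, hw, ?_⟩⟩)⟩
  exact (collecting_of_counter_eq (le_antisymm (hm ▸ counter_mono o hcm.le)
    (ha ▸ counter_mono o hac))).updates_eq i

/-- A worker still pending in `S` is the witness: a single report during this Phase 2 would have
removed it. -/
theorem exists_idle_of_counter_lt {a m r : ℕ} (ha : r * n < counter o a)
    (hm : counter o m < (r + 1) * n) (ham : a ≤ m) :
    ∃ i, ∀ c, a ≤ c → c < m → worker o c ≠ i := by
  have h := applying_of_counter_lt (ha.trans_le (counter_mono o ham)) hm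
  obtain ⟨i, hi⟩ := h.nonempty
  refine ⟨i, fun c hac hcm hw => ?_⟩
  have hc := applying_of_counter_lt (ha.trans_le (counter_mono o hac))
    ((counter_mono o hcm.le).trans_lt hm)
  have h1 := updates_succ_of_applying hc
  have h2 := updates_mono (o := o) i (Nat.succ_le_of_lt hcm)
  simp only [h.updates_eq, ← hw, Nat.succ_eq_add_one, h1] at h2
  have h3 := h.updates_eq (worker o c)
  rw [hw, if_pos hi] at h3
  rw [hw] at h2
  simp [hi] at h2

end Counter

/-! ### Real time: upper bounds for phases and rounds -/

section Clock

variable {n : ℕ} {τ : Fin n → ℝ} (o : ArrivalOrder n τ)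

/-- The arrival number of the `l`-th gradient of worker `i`. -/
def position (i : Fin n) (l : ℕ) : ℕ := o.toEquiv.symm (i, l)

/-- The number of gradients of worker `i` among the first `a` arrivals. -/
def delivered (a : ℕ) (i : Fin n) : ℕ := sInf {l | a ≤ position o i l}

variable {o}

@[simp] theorem toEquiv_position (i : Fin n) (l : ℕ) : o.toEquiv (position o i l) = (i, l) := by
  simp [position]

@[simp] theorem worker_position (i : Fin n) (l : ℕ) : worker o (position o i l) = i := by
  simp [worker]

theorem position_toEquiv (m : ℕ) : position o (worker o m) (o.toEquiv m).2 = m := by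
  simp [position, worker]

theorem clock_succ_le {m m' : ℕ} (h : m ≤ m') : clock o (m + 1) ≤ clock o (m' + 1) :=
  o.monotone_time h

theorem clock_position_succ (i : Fin n) (l : ℕ) :
    clock o (position o i l + 1) = ((l : ℝ) + 1) * τ i := by
  simp [clock, finishTime]

variable (hτ : ∀ i, 0 < τ i)
include hτ

theorem clock_nonneg (m : ℕ) : 0 ≤ clock o m := by
  cases m with
  | zero => exact le_rfl
  | succ m => exact mul_nonneg (by positivity) (hτ _).le

theorem clock_mono : Monotone (clock o) := by
  intro m m' h
  cases m with
  | zero => exact clock_nonneg hτ m'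
  | succ m =>
    cases m' with
    | zero => omega
    | succ m' => exact clock_succ_le (Nat.succ_le_succ_iff.1 h)

theorem position_strictMono (i : Fin n) : StrictMono (position o i) := by
  intro l l' h
  by_contra hc
  have h1 := clock_succ_le (o := o) (not_lt.1 hc)
  rw [clock_position_succ, clock_position_succ] at h1
  have h2 := le_of_mul_le_mul_right h1 (hτ i)
  have h3 : (l : ℝ) < l' := by exact_mod_cast h
  linarith

theorem le_position_delivered (a : ℕ) (i : Fin n) : a ≤ position o i (delivered o a i) :=
  Nat.sInf_mem (s := {l | a ≤ position o i l}) ⟨a, (position_strictMono hτ i).id_le a⟩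

/-- Since positions increase strictly in `l`, the infimum defining `delivered` really counts the
gradients of worker i before `a`. -/
theorem position_lt_iff {a l : ℕ} {i : Fin n} : position o i l < a ↔ l < delivered o a i := by
  constructor
  · intro h
    by_contra hc
    exact absurd ((le_position_delivered hτ a i).trans
      ((position_strictMono hτ i).monotone (not_lt.1 hc))) (not_le.2 h)
  · intro h
    by_contra hc
    exact Nat.notMem_of_lt_sInf h (not_lt.1 hc)

theorem delivered_mul_le_clock (a : ℕ) (i : Fin n) : (delivered o a i : ℝ) * τ i ≤ clock o a := by
  rcases Nat.eq_zero_or_pos (delivered o a i) with h | h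
  · rw [h]; simpa using clock_nonneg hτ a
  · obtain ⟨l, hl⟩ := Nat.exists_eq_succ_of_ne_zero h.ne'
    have h1 : position o i l < a := (position_lt_iff hτ).2 (by omega)
    have h2 := clock_mono (o := o) hτ (Nat.succ_le_of_lt h1)
    rw [Nat.succ_eq_add_one, clock_position_succ] at h2
    rw [hl]
    exact_mod_cast h2

theorem clock_le_delivered_add_one_mul (a : ℕ) (i : Fin n) :
    clock o a ≤ ((delivered o a i : ℝ) + 1) * τ i := by
  rw [← clock_position_succ (o := o)]
  exact clock_mono hτ ((le_position_delivered hτ a i).trans (Nat.le_succ _))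

/-- The next gradient of the silent worker was begun no later than `clock o a`, hence finishes
within τ_i after it, and arrival `m` does not come after that gradient. -/
theorem clock_succ_le_of_idle {a m : ℕ} {i : Fin n}
    (h : ∀ c, a ≤ c → c < m → worker o c ≠ i) : clock o (m + 1) ≤ clock o a + τ i := by
  have h1 : m ≤ position o i (delivered o a i) := by
    by_contra hc
    exact h _ (le_position_delivered hτ a i) (not_le.1 hc) (worker_position _ _)
  have h2 := clock_succ_le (o := o) h1
  rw [clock_position_succ] at h2
  linarith [delivered_mul_le_clock (o := o) hτ a i]

omit hτ in
theorem le_slowest (i : Fin n) : τ i ≤ slowest τ := le_ciSup (Set.finite_range τ).bddAbove i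

theorem exists_lt_clock (t : ℝ) : ∃ m, t < clock o m := by
  obtain ⟨l, hl⟩ := exists_nat_gt (t / τ (worker o 0))
  refine ⟨position o (worker o 0) l + 1, ?_⟩
  rw [clock_position_succ]
  rw [div_lt_iff₀ (hτ _)] at hl
  linarith [hτ (worker o 0)]

/-- A bound on the time spent in a single phase. -/
theorem clock_succ_le_of_phase {a m r : ℕ} (ham : a ≤ m)
    (h : (counter o a = r * n ∧ counter o m = r * n) ∨
      (r * n < counter o a ∧ counter o m < (r + 1) * n)) :
    clock o (m + 1) ≤ clock o a + slowest τ := by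
  have : ∃ i, ∀ c, a ≤ c → c < m → worker o c ≠ i := by
    rcases h with h | h
    · exact exists_idle_of_counter_eq h.1 h.2
    · exact exists_idle_of_counter_lt h.1 h.2 ham
  obtain ⟨i, hi⟩ := this
  linarith [clock_succ_le_of_idle hτ hi, le_slowest (τ := τ) i]

/-- If the counter stuck at `k`, one phase would last forever, although a phase takes at most τ_n
and the clock is unbounded. This makes the infimum in `arrivalsUntil` attained. -/
theorem exists_counter_eq (k : ℕ) : ∃ m, counter o m = k := by
  induction k with
  | zero => exact ⟨0, rfl⟩
  | succ k ih =>
    obtain ⟨a, ha⟩ := ih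
    by_contra! hc
    have hstay : ∀ j, counter o (a + j) = k := fun j => by
      induction j with
      | zero => exact ha
      | succ j ih =>
        by_contra hne
        have := counter_succ_of_ne (o := o) (m := a + j) (by rw [ih]; exact hne)
        exact hc _ (this.trans (by rw [ih]))
    obtain ⟨m, hm⟩ := exists_lt_clock (o := o) hτ (clock o a + slowest τ)
    have h1 : clock o (a + m + 1) ≤ clock o a + slowest τ := by
      refine clock_succ_le_of_phase (r := k / n) hτ (Nat.le_add_right _ _) ?_
      rw [hstay, ha]
      have h2 := Nat.div_add_mod k n
      have h3 := Nat.mod_lt k (card_pos o)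
      rw [Nat.mul_comm] at h2
      rw [Nat.add_mul]
      rcases Nat.eq_zero_or_pos (k % n) with h4 | h4
      · left; omega
      · right; omega
    linarith [clock_mono (o := o) hτ (show m ≤ a + m + 1 by omega)]

theorem counter_arrivalsUntil (k : ℕ) : counter o (arrivalsUntil o k) = k :=
  Nat.sInf_mem (s := {m | (bookkeeping o m).k = k}) (exists_counter_eq hτ k)

omit hτ in
theorem arrivalsUntil_le {m k : ℕ} (h : counter o m = k) : arrivalsUntil o k ≤ m :=
  Nat.sInf_le h

theorem arrivalsUntil_le_iff {m k : ℕ} : arrivalsUntil o k ≤ m ↔ k ≤ counter o m := by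
  constructor
  · intro h
    rw [← counter_arrivalsUntil (o := o) hτ k]
    exact counter_mono o h
  · intro h
    by_contra hc
    have h1 := counter_mono o (not_le.1 hc).le
    rw [counter_arrivalsUntil hτ] at h1
    exact hc (arrivalsUntil_le (le_antisymm h1 h))

theorem arrivalsUntil_mono : Monotone (arrivalsUntil o) := fun k k' h => by
  rw [arrivalsUntil_le_iff hτ, counter_arrivalsUntil hτ]
  exact h

theorem exists_arrivalsUntil_succ (k : ℕ) :
    ∃ m, arrivalsUntil o (k + 1) = m + 1 ∧ counter o m = k ∧ counter o (m + 1) = k + 1 := by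
  have h0 : arrivalsUntil o (k + 1) ≠ 0 := fun h => by
    have := counter_arrivalsUntil (o := o) hτ (k + 1)
    rw [h, counter_zero] at this
    omega
  obtain ⟨m, hm⟩ := Nat.exists_eq_succ_of_ne_zero h0
  have h1 : counter o (m + 1) = k + 1 := by
    have := counter_arrivalsUntil (o := o) hτ (k + 1)
    rwa [hm] at this
  have h2 : counter o m < k + 1 := by
    by_contra hc
    have := (arrivalsUntil_le_iff (o := o) hτ).2 (not_lt.1 hc)
    omega
  have h3 := counter_succ_of_ne (o := o) (m := m) (by omega)
  exact ⟨m, hm, by omega, h1⟩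

theorem iterateTime_mono : Monotone (iterateTime o) := fun _ _ h =>
  clock_mono hτ (arrivalsUntil_mono hτ h)

omit hτ in
theorem iterateTime_zero : iterateTime o 0 = 0 := by
  have : arrivalsUntil o 0 = 0 := Nat.le_zero.1 (arrivalsUntil_le rfl)
  rw [iterateTime, this]
  rfl

theorem iterateTime_collect (r : ℕ) :
    iterateTime o (r * n + 1) ≤ iterateTime o (r * n) + slowest τ := by
  obtain ⟨m, h1, h2, -⟩ := exists_arrivalsUntil_succ (o := o) hτ (r * n)
  rw [iterateTime, h1]
  exact clock_succ_le_of_phase hτ (arrivalsUntil_le h2)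
    (Or.inl ⟨counter_arrivalsUntil hτ _, h2⟩)

theorem iterateTime_apply {r k : ℕ} (h : r * n < k) (h' : k ≤ (r + 1) * n) :
    iterateTime o k ≤ iterateTime o (r * n + 1) + slowest τ := by
  have hs : 0 ≤ slowest τ := (hτ (worker o 0)).le.trans (le_slowest _)
  rcases Nat.eq_or_lt_of_le (Nat.succ_le_of_lt h) with he | hl
  · rw [← he]; simpa using hs
  · obtain ⟨k, rfl⟩ := Nat.exists_eq_succ_of_ne_zero (show k ≠ 0 by omega)
    obtain ⟨m, h1, h2, -⟩ := exists_arrivalsUntil_succ (o := o) hτ k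
    rw [iterateTime, Nat.succ_eq_add_one, h1]
    refine clock_succ_le_of_phase (r := r) hτ ((arrivalsUntil_le_iff hτ).2 (by omega))
      (Or.inr ⟨?_, by omega⟩)
    rw [counter_arrivalsUntil hτ]
    exact Nat.lt_succ_self _

theorem iterateTime_le (R : ℕ) : iterateTime o (R * n) ≤ 2 * slowest τ * R := by
  induction R with
  | zero => simp [iterateTime_zero]
  | succ R ih =>
    have h1 := iterateTime_collect (o := o) hτ R
    have h2 := iterateTime_apply (o := o) hτ (r := R) (k := (R + 1) * n)
      (by rw [Nat.add_mul]; have := card_pos o; omega) le_rfl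
    push_cast
    linarith

end Clock

/-! ### Lower bounds for the batch sizes and for B -/

section Batch

variable {n : ℕ} {τ : Fin n → ℝ} {o : ArrivalOrder n τ}

theorem arrivals_nonempty {k : ℕ} (hτ : ∀ i, 0 < τ i) (i : Fin n) :
    (arrivals o (arrivalsUntil o (k + 1)) (k / n) i).Nonempty := by
  obtain ⟨m, h1, h2, h3⟩ := exists_arrivalsUntil_succ (o := o) hτ k
  have h := (bookkeeping_moves (o := o) (m := m) (by omega)).full i
  rwa [h2, ← h1] at h

theorem batch_eq (hτ : ∀ i, 0 < τ i) (k : ℕ) (i : Fin n) :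
    batch o k i = (arrivals o (arrivalsUntil o (k + 1)) (k / n) i).card := by
  obtain ⟨m, h1, h2, h3⟩ := exists_arrivalsUntil_succ (o := o) hτ k
  have h := bookkeeping_moves (o := o) (m := m) (by omega)
  obtain ⟨S, ht⟩ := (inRound_bookkeeping o m).exists_table
  have ht' := ht.arrive h.updates_eq
  rw [h2] at ht'
  rw [h1, ← ht'.count]
  simp [batch, h1, worker]

theorem batch_pos (hτ : ∀ i, 0 < τ i) (k : ℕ) (i : Fin n) : 0 < batch o k i := by
  rw [batch_eq hτ]
  exact (arrivals_nonempty hτ i).card_pos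

/-- The first updates of two consecutive rounds are at least `τᵢ` seconds apart, for every `i`. -/
theorem iterateTime_round_succ_ge (hτ : ∀ i, 0 < τ i) (r : ℕ) (i : Fin n) :
    iterateTime o (r * n + 1) + τ i ≤ iterateTime o ((r + 1) * n + 1) := by
  have hn := card_pos o
  obtain ⟨c, hc⟩ := arrivals_nonempty (o := o) (k := (r + 1) * n) hτ i
  rw [Nat.mul_div_cancel _ hn] at hc
  obtain ⟨h1, h2, h3⟩ := mem_arrivals.1 hc
  -- Worker i can contribute `c` to the table of round r + 1 only after being served in round r. So
  -- it has an earlier arrival `a` at or after the first update of round r, and two arrivals of one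
  -- worker are at least τ_i apart.
  have hex : ∃ a < c, worker o a = i ∧ r * n < counter o (a + 1) := by
    by_contra! hno
    have key : ∀ a ≤ c, updates o a i ≤ r := fun a => by
      induction a with
      | zero => intro _; exact Nat.zero_le _
      | succ a ih =>
        intro ha
        have ih := ih (by omega)
        simp only [updates]
        split_ifs with hu
        · have h4 := hno a (by omega) hu.1
          have h5 := (bookkeeping_moves hu.2).updates_eq
          rw [hu.1] at h5
          have h6 := counter_succ_of_ne hu.2
          have h7 : counter o a / n < r := by
            rw [Nat.div_lt_iff_lt_mul hn]; omega
          omega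
        · omega
    have := key c le_rfl
    omega
  obtain ⟨a, hac, hwa, hka⟩ := hex
  have h4 : iterateTime o (r * n + 1) ≤ clock o (a + 1) :=
    clock_mono hτ ((arrivalsUntil_le_iff hτ).2 (by omega))
  have h5 : clock o (c + 1) ≤ iterateTime o ((r + 1) * n + 1) :=
    clock_mono hτ (Nat.succ_le_of_lt h1)
  have h6 : clock o (a + 1) + τ i ≤ clock o (c + 1) := by
    have ha := position_toEquiv (o := o) a
    have hc' := position_toEquiv (o := o) c
    rw [hwa] at ha
    rw [h2] at hc'
    rw [← ha, ← hc', clock_position_succ, clock_position_succ]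
    have h7 : (o.toEquiv a).2 < (o.toEquiv c).2 := by
      rw [← (position_strictMono (o := o) hτ i).lt_iff_lt, ha, hc']
      exact hac
    have h8 : ((o.toEquiv a).2 : ℝ) + 1 ≤ (o.toEquiv c).2 := by exact_mod_cast h7
    nlinarith [hτ i]
  linarith

theorem le_iterateTime_one (hτ : ∀ i, 0 < τ i) (i : Fin n) : τ i ≤ iterateTime o 1 := by
  obtain ⟨c, hc⟩ := arrivals_nonempty (o := o) (k := 0) hτ i
  obtain ⟨h1, h2, -⟩ := mem_arrivals.1 hc
  have h5 : clock o (c + 1) ≤ iterateTime o 1 := clock_mono hτ (Nat.succ_le_of_lt h1)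
  refine le_trans ?_ h5
  rw [clock, finishTime, show (o.toEquiv c).1 = i from h2]
  nlinarith [hτ i, Nat.cast_nonneg (α := ℝ) (o.toEquiv c).2]

theorem updates_le_of_counter_le {a r : ℕ} (h : counter o a ≤ r * n) (i : Fin n) :
    updates o a i ≤ r := by
  rcases h.lt_or_eq with h1 | h1
  · have h2 : counter o a / n < r := (Nat.div_lt_iff_lt_mul (card_pos o)).2 h1
    exact ((inRound_bookkeeping o a).updates_le i).trans h2
  · exact ((collecting_of_counter_eq h1).updates_eq i).le

theorem succ_le_updates_succ {a r : ℕ} (h : r * n < counter o a) :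
    r + 1 ≤ updates o (a + 1) (worker o a) := by
  rcases lt_or_ge (counter o a) ((r + 1) * n) with h1 | h1
  · exact (updates_succ_of_applying (applying_of_counter_lt h h1)).ge
  · have h2 := (Nat.le_div_iff_mul_le (card_pos o)).2 h1
    exact (h2.trans ((inRound_bookkeeping o a).le_updates _)).trans
      (updates_mono _ (Nat.le_succ a))

/-- Up to the arrival that makes the first update of round r, nobody has more than r updates. So
gradients from number `N` on have exactly r, and at most the first `N` miss the table. -/
theorem card_arrivals_ge (hτ : ∀ i, 0 < τ i) (r : ℕ) (i : Fin n) {N : ℕ}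
    (hN : ∀ l, N ≤ l → r ≤ updates o (position o i l) i) :
    delivered o (arrivalsUntil o (r * n + 1)) i ≤
      N + (arrivals o (arrivalsUntil o (r * n + 1)) r i).card := by
  have hsub : (Finset.Ico N (delivered o (arrivalsUntil o (r * n + 1)) i)).image (position o i) ⊆
      arrivals o (arrivalsUntil o (r * n + 1)) r i := by
    intro c hc
    obtain ⟨l, hl, rfl⟩ := Finset.mem_image.1 hc
    rw [Finset.mem_Ico, ← position_lt_iff hτ] at hl
    refine mem_arrivals.2 ⟨hl.2, worker_position _ _, le_antisymm ?_ (hN l hl.1)⟩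
    refine updates_le_of_counter_le ?_ _
    by_contra hc
    have := (arrivalsUntil_le_iff (o := o) (k := r * n + 1) hτ).2 (not_le.1 hc)
    omega
  have h := Finset.card_le_card hsub
  rw [Finset.card_image_of_injective _ (position_strictMono hτ i).injective, Nat.card_Ico] at h
  omega

/-- The first updates of the previous and of the current round are at least τ_n apart. In between,
worker i delivers at least τ_n/τ_i - 1 gradients, and at most one of them goes to the old table;
hence the 2. -/
theorem batch_ge (hτ : ∀ i, 0 < τ i) (k : ℕ) (i : Fin n) :
    slowest τ ≤ ((batch o k i : ℝ) + 2) * τ i := by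
  have hn := card_pos o
  have : Nonempty (Fin n) := ⟨i⟩
  have hsub : (arrivals o (arrivalsUntil o (k / n * n + 1)) (k / n) i).card ≤ batch o k i := by
    rw [batch_eq hτ]
    refine Finset.card_le_card (arrivals_mono (arrivalsUntil_mono hτ ?_) _ _)
    have := Nat.div_mul_le_self k n
    omega
  have hsub' : ((arrivals o (arrivalsUntil o (k / n * n + 1)) (k / n) i).card : ℝ) ≤
      batch o k i := by
    exact_mod_cast hsub
  have hup := clock_le_delivered_add_one_mul (o := o) hτ (arrivalsUntil o (k / n * n + 1)) i
  rcases hr : k / n with _ | r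
  -- Round 0 has no predecessor: the interval starts at time 0 and no gradient is lost.
  · rw [hr] at hsub' hup
    have h1 := card_arrivals_ge (o := o) hτ 0 i (N := 0) (fun _ _ => Nat.zero_le _)
    have h2 : (delivered o (arrivalsUntil o (0 * n + 1)) i : ℝ) ≤
        (arrivals o (arrivalsUntil o (0 * n + 1)) 0 i).card := by exact_mod_cast (by omega)
    have h3 : slowest τ ≤ clock o (arrivalsUntil o (0 * n + 1)) := by
      rw [Nat.zero_mul, Nat.zero_add]
      exact ciSup_le (le_iterateTime_one (o := o) hτ)
    nlinarith [hτ i]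
  · rw [hr] at hsub' hup
    set a := arrivalsUntil o (r * n + 1) with ha
    -- Gradient number `delivered o a i` is the first report of worker i at or after `a`. It may
    -- still belong to round r, but after it the worker has at least r + 1 updates.
    have h1 := card_arrivals_ge (o := o) hτ (r + 1) i (N := delivered o a i + 1) (fun l hl => by
      have h4 : r * n < counter o (position o i (delivered o a i)) :=
        (arrivalsUntil_le_iff (o := o) (k := r * n + 1) hτ).1 (le_position_delivered hτ a i)
      have h5 := succ_le_updates_succ h4
      rw [worker_position] at h5
      exact h5.trans (updates_mono i ((position_strictMono (o := o) hτ i) hl)))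
    have h2 : (delivered o (arrivalsUntil o ((r + 1) * n + 1)) i : ℝ) ≤ delivered o a i + 1 +
        (arrivals o (arrivalsUntil o ((r + 1) * n + 1)) (r + 1) i).card := by exact_mod_cast h1
    have h3 : slowest τ ≤ clock o (arrivalsUntil o ((r + 1) * n + 1)) - clock o a :=
      ciSup_le fun j => by
        have := iterateTime_round_succ_ge (o := o) hτ r j
        rw [iterateTime, iterateTime] at this
        linarith
    have h4 := delivered_mul_le_clock (o := o) hτ a i
    nlinarith [hτ i]

/-- Since b ≥ 1, the bound b + 2 ≤ 3b turns the additive loss of `batch_ge` into a factor 3. -/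
theorem one_div_batch_le (hτ : ∀ i, 0 < τ i) (k : ℕ) (i : Fin n) :
    1 / (batch o k i : ℝ) ≤ 3 * τ i / slowest τ := by
  have hs : 0 < slowest τ := (hτ i).trans_le (le_slowest i)
  have hb : (1 : ℝ) ≤ batch o k i := by exact_mod_cast batch_pos hτ k i
  rw [div_le_div_iff₀ (by linarith) hs]
  nlinarith [batch_ge (o := o) hτ k i, hτ i]

theorem average_pos (hτ : ∀ i, 0 < τ i) (o : ArrivalOrder n τ) : 0 < average τ := by
  have hn : (0 : ℝ) < n := by exact_mod_cast card_pos o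
  exact mul_pos (by positivity) (Finset.sum_pos (fun i _ => hτ i) ⟨worker o 0, Finset.mem_univ _⟩)

theorem mean_one_div_batch_pos (hτ : ∀ i, 0 < τ i) (k : ℕ) :
    0 < (1 / (n : ℝ)) * ∑ i, 1 / (batch o k i : ℝ) := by
  have hn : (0 : ℝ) < n := by exact_mod_cast card_pos o
  refine mul_pos (by positivity) (Finset.sum_pos (fun i _ => ?_) ⟨worker o 0, Finset.mem_univ _⟩)
  have : (0 : ℝ) < batch o k i := by exact_mod_cast batch_pos hτ k i
  positivity

theorem harmonicBatch_ge (hτ : ∀ i, 0 < τ i) (k : ℕ) :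
    slowest τ / (3 * average τ) ≤ harmonicBatch o k := by
  have hn : (0 : ℝ) < n := by exact_mod_cast card_pos o
  have hs : 0 < slowest τ := (hτ (worker o 0)).trans_le (le_slowest _)
  rw [harmonicBatch, ← inv_div]
  refine inv_anti₀ (mean_one_div_batch_pos hτ k) ?_
  rw [average, ← mul_assoc, mul_comm (3 : ℝ), mul_assoc, mul_div_assoc]
  refine mul_le_mul_of_nonneg_left ?_ (by positivity)
  rw [Finset.mul_sum, Finset.sum_div]
  exact Finset.sum_le_sum fun i _ => one_div_batch_le hτ k i

theorem minBatch_ge (hτ : ∀ i, 0 < τ i) : slowest τ / (3 * average τ) ≤ minBatch o :=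
  le_ciInf fun k => harmonicBatch_ge hτ k

theorem minBatch_pos (hτ : ∀ i, 0 < τ i) : 0 < minBatch o := by
  have hs : 0 < slowest τ := (hτ (worker o 0)).trans_le (le_slowest _)
  have := average_pos hτ o
  exact lt_of_lt_of_le (by positivity) (minBatch_ge hτ)

theorem minBatch_le (hτ : ∀ i, 0 < τ i) (k : ℕ) : minBatch o ≤ harmonicBatch o k :=
  ciInf_le ⟨0, by
    rintro _ ⟨k, rfl⟩
    exact (inv_pos.2 (mean_one_div_batch_pos hτ k)).le⟩ k

theorem mean_one_div_batch_le (hτ : ∀ i, 0 < τ i) (k : ℕ) :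
    (1 / (n : ℝ)) * ∑ i, 1 / (batch o k i : ℝ) ≤ 1 / minBatch o := by
  rw [one_div (minBatch o), le_inv_comm₀ (mean_one_div_batch_pos hτ k) (minBatch_pos hτ)]
  exact minBatch_le hτ k

end Batch

/-! ### A closed recursion for the iterates -/

section Iterates

variable {n : ℕ} {τ : Fin n → ℝ} (o : ArrivalOrder n τ)

/-- The index of the iterate at which worker `i` computes its gradients for the table of
round `ρ`. -/
def modelIndex (ρ : ℕ) (i : Fin n) : ℕ := counter o (sInf {m | updates o m i = ρ})

/-- The numbers of the gradients of worker `i` averaged in the step from `xᵏ` to `xᵏ⁺¹`. -/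
def table (k : ℕ) (i : Fin n) : Finset ℕ :=
  (arrivals o (arrivalsUntil o (k + 1)) (k / n) i).image fun a => (o.toEquiv a).2

variable {o}

theorem injOn_arrivals (m ρ : ℕ) (i : Fin n) :
    Set.InjOn (fun a => (o.toEquiv a).2) (arrivals o m ρ i : Set ℕ) := by
  intro a ha a' ha' h
  have h1 : worker o a = i := (mem_arrivals.1 ha).2.1
  have h2 : worker o a' = i := (mem_arrivals.1 ha').2.1
  rw [← position_toEquiv (o := o) a, ← position_toEquiv (o := o) a', h1, h2]
  exact congrArg _ h

theorem card_table (hτ : ∀ i, 0 < τ i) (k : ℕ) (i : Fin n) :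
    (table o k i).card = batch o k i := by
  rw [table, Finset.card_image_of_injOn (injOn_arrivals _ _ _), batch_eq hτ]

theorem updates_position_of_mem_table {k : ℕ} {i : Fin n} {l : ℕ} (h : l ∈ table o k i) :
    updates o (position o i l) i = k / n := by
  obtain ⟨a, ha, rfl⟩ := Finset.mem_image.1 h
  obtain ⟨-, h2, h3⟩ := mem_arrivals.1 ha
  have := position_toEquiv (o := o) a
  rw [h2] at this
  rwa [this]

theorem div_eq_div_of_mem_table {k k' : ℕ} {i : Fin n} {l : ℕ} (h : l ∈ table o k i)
    (h' : l ∈ table o k' i) : k / n = k' / n :=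
  (updates_position_of_mem_table h).symm.trans (updates_position_of_mem_table h')

theorem modelIndex_zero (i : Fin n) : modelIndex o 0 i = 0 := by
  have : sInf {m | updates o m i = 0} = 0 := Nat.sInf_eq_zero.2 (Or.inl rfl)
  rw [modelIndex, this, counter_zero]

/-- The update number ρ + 1 of a worker is one of the n steps of round ρ. Consequently the points
used in a step are less than 2n steps old. -/
theorem modelIndex_succ_mem (hτ : ∀ i, 0 < τ i) (ρ : ℕ) (i : Fin n) :
    ρ * n < modelIndex o (ρ + 1) i ∧ modelIndex o (ρ + 1) i ≤ (ρ + 1) * n := by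
  have hne : {m | updates o m i = ρ + 1}.Nonempty :=
    ⟨_, (collecting_of_counter_eq (counter_arrivalsUntil (o := o) hτ ((ρ + 1) * n))).updates_eq i⟩
  have hmem : updates o (sInf {m | updates o m i = ρ + 1}) i = ρ + 1 := Nat.sInf_mem hne
  rw [modelIndex]
  rcases hm : sInf {m | updates o m i = ρ + 1} with _ | m
  · rw [hm] at hmem
    simp [updates] at hmem
  · rw [hm] at hmem
    have h1 : updates o m i ≠ ρ + 1 := fun h => by
      have := Nat.sInf_le (s := {m | updates o m i = ρ + 1}) h
      omega
    simp only [updates] at hmem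
    split_ifs at hmem with hu
    · have h2 := (bookkeeping_moves hu.2).updates_eq
      rw [hu.1] at h2
      have h3 : counter o m / n = ρ := by omega
      rw [counter_succ_of_ne hu.2]
      have h4 := Nat.div_add_mod (counter o m) n
      have h5 := Nat.mod_lt (counter o m) (card_pos o)
      rw [h3, Nat.mul_comm] at h4
      rw [Nat.add_mul]
      omega
    · exact absurd hmem h1

variable {E : Type*} [AddCommGroup E] [Module ℝ E] (γ : ℝ) (x₀ : E) (g : Fin n → ℕ → E → E)

theorem iterate_zero : iterate o γ x₀ g 0 = x₀ := by
  have : arrivalsUntil o 0 = 0 := Nat.le_zero.1 (arrivalsUntil_le rfl)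
  rw [iterate, this]
  rfl

theorem run_x (m : ℕ) : (run o γ x₀ g m).x = iterate o γ x₀ g (counter o m) := by
  induction m with
  | zero => exact (iterate_zero γ x₀ g).symm
  | succ m ih =>
    by_cases h : counter o (m + 1) = counter o m
    · rw [(run_stays γ x₀ g h).x, ih, h]
    · have h1 : arrivalsUntil o (counter o (m + 1)) = m + 1 := by
        refine le_antisymm (arrivalsUntil_le rfl) ?_
        by_contra hc
        have h2 := counter_mono o (Nat.lt_succ_iff.1 (not_le.1 hc))
        have h3 : counter o (arrivalsUntil o (counter o (m + 1))) = counter o (m + 1) :=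
          Nat.sInf_mem (s := {m' | (bookkeeping o m').k = counter o (m + 1)}) ⟨m + 1, rfl⟩
        have h4 := counter_succ_of_ne h
        omega
      rw [iterate, h1]

/-- The point of a worker changes exactly when its update count does, and the infimum in
`modelIndex` is the moment of that change. -/
theorem run_model (m : ℕ) (i : Fin n) :
    (run o γ x₀ g m).model i = iterate o γ x₀ g (modelIndex o (updates o m i) i) := by
  induction m with
  | zero => exact (by rw [updates, modelIndex_zero, iterate_zero]; rfl)
  | succ m ih =>
    by_cases h : counter o (m + 1) = counter o m
    · rw [(run_stays γ x₀ g h).model, ih, updates_succ_of_eq h]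
    · by_cases hi : worker o m = i
      · have h1 : sInf {m' | updates o m' i = updates o (m + 1) i} = m + 1 := by
          refine le_antisymm (Nat.sInf_le rfl) (le_csInf ⟨m + 1, rfl⟩ fun m' hm' => ?_)
          by_contra hc
          have h2 := updates_mono (o := o) i (Nat.lt_succ_iff.1 (not_le.1 hc))
          have h3 := updates_succ_of_ne h i
          rw [if_pos hi] at h3
          replace hm' : updates o m' i = updates o (m + 1) i := hm'
          simp only at h2
          omega
        rw [modelIndex, h1, (run_moves γ x₀ g h).model, ← run_x, hi, Function.update_self]
      · rw [(run_moves γ x₀ g h).model, Function.update_of_ne (Ne.symm hi), ih,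
          updates_succ_of_ne h, if_neg hi, Nat.add_zero]

/-- The bridge from the server to the analysis, obtained by reading the table at the arrival that
triggers the step. Only `table`, `batch` and `modelIndex` survive. -/
theorem iterate_succ (hτ : ∀ i, 0 < τ i) (k : ℕ) :
    iterate o γ x₀ g (k + 1) = iterate o γ x₀ g k - γ • ((1 / (n : ℝ)) • ∑ i,
      (1 / (batch o k i : ℝ)) • ∑ l ∈ table o k i,
        g i l (iterate o γ x₀ g (modelIndex o (k / n) i))) := by
  obtain ⟨m, h1, h2, h3⟩ := exists_arrivalsUntil_succ (o := o) hτ k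
  have hmv := run_moves (o := o) γ x₀ g (m := m) (by omega)
  obtain ⟨S, ht⟩ := (inRound_run (o := o) γ x₀ g m).exists_table
  have ht' := ht.arrive hmv.updates_eq
  have hx : iterate o γ x₀ g k = (run o γ x₀ g m).x := by rw [run_x, h2]
  have hx' : iterate o γ x₀ g (k + 1) = (run o γ x₀ g (m + 1)).x := by rw [run_x, h3]
  rw [hx', hmv.x, State.nextIterate, hx]
  refine congrArg (fun w => (run o γ x₀ g m).x - γ • ((1 / (n : ℝ)) • w)) ?_
  refine Finset.sum_congr rfl fun i _ => ?_
  have hb := ht'.count i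
  have hG := ht'.sum i
  rw [h2, ← h1] at hb hG
  rw [← batch_eq hτ] at hb
  simp only [State.store, hb, hG]
  rw [table, Finset.sum_image (injOn_arrivals _ _ _)]
  congr 1
  refine Finset.sum_congr rfl fun a ha => ?_
  obtain ⟨-, h4, h5⟩ := mem_arrivals.1 ha
  rw [received, run_model, h4, h5, show (o.toEquiv a).1 = i from h4]

end Iterates

/-! ### Quadratic bounds for functions with Lipschitz gradient -/

section Smooth

variable {E : Type*} [NormedAddCommGroup E] [InnerProductSpace ℝ E] [CompleteSpace E]
  {f : E → ℝ} {L : ℝ}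

/-- Along the segment, f minus its linear part and minus the quadratic term has nonpositive
derivative. -/
theorem le_add_inner_gradient (hf : Differentiable ℝ f)
    (hL : ∀ x y, ‖gradient f x - gradient f y‖ ≤ L * ‖x - y‖) (x y : E) :
    f y ≤ f x + inner ℝ (gradient f x) (y - x) + L / 2 * ‖y - x‖ ^ 2 := by
  set φ : ℝ → ℝ := fun t => f (x + t • (y - x)) - t * inner ℝ (gradient f x) (y - x)
    - L / 2 * ‖y - x‖ ^ 2 * t ^ 2 with hφ
  have hd : ∀ t : ℝ, HasDerivAt φ (inner ℝ (gradient f (x + t • (y - x))) (y - x)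
      - inner ℝ (gradient f x) (y - x) - L / 2 * ‖y - x‖ ^ 2 * (2 * t)) t := fun t => by
    have h1 : HasDerivAt (fun t : ℝ => x + t • (y - x)) (y - x) t := by
      simpa using ((hasDerivAt_id t).smul_const (y - x)).const_add x
    have h2 := (hf (x + t • (y - x))).hasGradientAt.hasFDerivAt.comp_hasDerivAt t h1
    have h3 := (hasDerivAt_id t).mul_const (inner ℝ (gradient f x) (y - x))
    have h4 := ((hasDerivAt_pow 2 t).const_mul (L / 2 * ‖y - x‖ ^ 2))
    exact ((h2.sub h3).sub h4).congr_deriv (by simp)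
  have hanti : AntitoneOn φ (Set.Icc 0 1) := by
    refine antitoneOn_of_deriv_nonpos (convex_Icc 0 1)
      (fun t _ => (hd t).continuousAt.continuousWithinAt)
      (fun t _ => (hd t).differentiableAt.differentiableWithinAt) fun t ht => ?_
    rw [interior_Icc] at ht
    rw [(hd t).deriv, ← inner_sub_left]
    have h1 := real_inner_le_norm (gradient f (x + t • (y - x)) - gradient f x) (y - x)
    have h2 := hL (x + t • (y - x)) x
    rw [add_sub_cancel_left, norm_smul, Real.norm_of_nonneg ht.1.le] at h2
    nlinarith [norm_nonneg (y - x), mul_le_mul_of_nonneg_right h2 (norm_nonneg (y - x))]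
  have h := hanti (Set.left_mem_Icc.2 zero_le_one) (Set.right_mem_Icc.2 zero_le_one) zero_le_one
  simp only [hφ, one_smul, zero_smul, add_zero, add_sub_cancel] at h
  linarith

theorem gradient_neg (hf : Differentiable ℝ f) (x : E) :
    gradient (fun y => -f y) x = -gradient f x := by
  have h := (hf x).hasGradientAt.hasFDerivAt.neg
  refine HasGradientAt.gradient ?_
  rw [hasGradientAt_iff_hasFDerivAt, map_neg]
  exact h

theorem add_inner_gradient_le (hf : Differentiable ℝ f)
    (hL : ∀ x y, ‖gradient f x - gradient f y‖ ≤ L * ‖x - y‖) (x y : E) :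
    f x + inner ℝ (gradient f x) (y - x) - L / 2 * ‖y - x‖ ^ 2 ≤ f y := by
  have h := le_add_inner_gradient (f := fun y => -f y) (L := L) hf.neg (fun x y => by
    rw [gradient_neg hf, gradient_neg hf, ← neg_sub', norm_neg]
    exact hL x y) x y
  rw [gradient_neg hf, inner_neg_left] at h
  linarith

/-- A gradient step of length 1/L lowers f by at least ‖∇f‖²/(2L), which cannot lead below `c`. This
serves the case in which x⁰ is already stationary. -/
theorem norm_gradient_sq_le (hf : Differentiable ℝ f) (hL0 : 0 < L)
    (hL : ∀ x y, ‖gradient f x - gradient f y‖ ≤ L * ‖x - y‖) {c : ℝ} (hc : ∀ x, c ≤ f x)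
    (x : E) : ‖gradient f x‖ ^ 2 ≤ 2 * L * (f x - c) := by
  have h := le_add_inner_gradient hf hL x (x - (1 / L) • gradient f x)
  have h1 := hc (x - (1 / L) • gradient f x)
  rw [sub_sub_cancel_left, inner_neg_right, norm_neg, norm_smul, inner_smul_right,
    real_inner_self_eq_norm_sq, Real.norm_of_nonneg (by positivity)] at h
  have h2 : L / 2 * (1 / L * ‖gradient f x‖) ^ 2 = 1 / (2 * L) * ‖gradient f x‖ ^ 2 := by
    field_simp
  have h3 : 1 / (2 * L) * ‖gradient f x‖ ^ 2 ≤ f x - c := by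
    have : (1 / L) * ‖gradient f x‖ ^ 2 = 2 * (1 / (2 * L) * ‖gradient f x‖ ^ 2) := by
      field_simp
    linarith
  calc ‖gradient f x‖ ^ 2 = 2 * L * (1 / (2 * L) * ‖gradient f x‖ ^ 2) := by field_simp
    _ ≤ _ := mul_le_mul_of_nonneg_left h3 (by positivity)

end Smooth

/-! ### Regularity of the objective and of the stochastic gradients -/

section Problem

variable {n d : ℕ} {Ξ : Fin n → Type u} [∀ i, MeasurableSpace (Ξ i)]
  {D : ∀ i, Measure (Ξ i)} {F : ∀ i, Vec d → Ξ i → ℝ} {L σ : ℝ}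

theorem AveragedSmooth.differentiable_objective (h : AveragedSmooth D F L) :
    Differentiable ℝ (objective D F) := by
  unfold objective
  have := h.differentiable
  fun_prop

theorem AveragedSmooth.gradient_objective (h : AveragedSmooth D F L) (x : Vec d) :
    gradient (objective D F) x =
      (1 / (n : ℝ)) • ∑ i, gradient (localObjective D F i) x := by
  refine HasGradientAt.gradient ?_
  rw [hasGradientAt_iff_hasFDerivAt, map_smul, map_sum]
  have h1 : HasFDerivAt (fun x => ∑ i, localObjective D F i x)
      (∑ i, InnerProductSpace.toDual ℝ (Vec d) (gradient (localObjective D F i) x)) x :=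
    HasFDerivAt.fun_sum fun i _ => (h.differentiable i x).hasGradientAt.hasFDerivAt
  exact h1.const_mul (1 / (n : ℝ))

theorem AveragedSmooth.gradient_lipschitz (h : AveragedSmooth D F L) (hn : 0 < n) (x y : Vec d) :
    ‖gradient (objective D F) x - gradient (objective D F) y‖ ≤ L * ‖x - y‖ := by
  have h1 := h.bound x fun _ => y
  rw [← h.gradient_objective, Finset.sum_const, Finset.card_univ, Fintype.card_fin,
    nsmul_eq_mul, ← mul_assoc, div_mul_cancel₀ _ (by positivity), ← mul_pow] at h1
  exact (sq_le_sq₀ (norm_nonneg _) (mul_nonneg h.pos.le (norm_nonneg _))).1 h1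

/-- Move only one of the n points in the averaged bound. The constant is crude (√n L would do),
since it serves only measurability and integrability. -/
theorem AveragedSmooth.local_gradient_lipschitz (h : AveragedSmooth D F L) (hn : 0 < n) (i : Fin n)
    (x y : Vec d) : ‖gradient (localObjective D F i) x - gradient (localObjective D F i) y‖ ≤
      L * n * ‖x - y‖ := by
  have h1 := h.bound x (Function.update (fun _ => x) i y)
  rw [h.gradient_objective, ← smul_sub, ← Finset.sum_sub_distrib,
    Finset.sum_eq_single i (fun j _ hj => by rw [Function.update_of_ne hj, sub_self])
      (fun hi => absurd (Finset.mem_univ i) hi),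
    Finset.sum_eq_single i (fun j _ hj => by rw [Function.update_of_ne hj, sub_self]; simp)
      (fun hi => absurd (Finset.mem_univ i) hi), Function.update_self, norm_smul,
    Real.norm_of_nonneg (by positivity)] at h1
  have hn1 : (1 : ℝ) ≤ n := by exact_mod_cast hn
  have hL := h.pos
  have h2 : (1 / (n : ℝ) * ‖gradient (localObjective D F i) x -
      gradient (localObjective D F i) y‖) ^ 2 ≤ (L * ‖x - y‖) ^ 2 := by
    refine h1.trans ?_
    rw [mul_pow]
    exact mul_le_mul_of_nonneg_right (div_le_self (by positivity) hn1) (by positivity)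
  have h3 := (sq_le_sq₀ (by positivity) (by positivity)).1 h2
  rw [one_div, inv_mul_le_iff₀ (by positivity)] at h3
  linarith

theorem AveragedSmooth.continuous_gradient (h : AveragedSmooth D F L) (hn : 0 < n) :
    Continuous (gradient (objective D F)) :=
  (LipschitzWith.of_dist_le_mul (K := L.toNNReal) fun x y => by
    rw [dist_eq_norm, dist_eq_norm, Real.coe_toNNReal _ h.pos.le]
    exact h.gradient_lipschitz hn x y).continuous

theorem AveragedSmooth.continuous_local_gradient (h : AveragedSmooth D F L) (hn : 0 < n)
    (i : Fin n) : Continuous (gradient (localObjective D F i)) :=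
  (LipschitzWith.of_dist_le_mul (K := (L * n).toNNReal) fun x y => by
    rw [dist_eq_norm, dist_eq_norm, Real.coe_toNNReal _ (mul_nonneg h.pos.le n.cast_nonneg)]
    exact h.local_gradient_lipschitz hn i x y).continuous

/-- The losses are jointly measurable, being continuous in x and measurable in z. Each coordinate of
the gradient is a limit of difference quotients. Joint measurability is what allows a random point
to be inserted. -/
theorem BoundedVariance.measurable_sampleGradient (h : BoundedVariance D F σ) (i : Fin n) :
    Measurable fun p : Vec d × Ξ i => sampleGradient F i p.2 p.1 := by
  have hF : Measurable fun p : Vec d × Ξ i => F i p.1 p.2 :=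
    measurable_uncurry_of_continuous_of_measurable (u := fun x z => F i x z)
      (fun z => (h.differentiable i z).continuous) (h.measurable i)
  have hinner : ∀ e : Vec d, Measurable fun p : Vec d × Ξ i =>
      inner ℝ e (sampleGradient F i p.2 p.1) := fun e => by
    refine measurable_of_tendsto_metrizable
      (f := fun (m : ℕ) (p : Vec d × Ξ i) =>
        (m : ℝ) • (F i (p.1 + (m : ℝ)⁻¹ • e) p.2 - F i p.1 p.2)) (fun m => ?_) ?_
    · have h1 : Measurable fun p : Vec d × Ξ i => (p.1 + (m : ℝ)⁻¹ • e, p.2) :=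
        (measurable_fst.add_const _).prodMk measurable_snd
      exact ((hF.comp h1).sub hF).const_smul (m : ℝ)
    · rw [tendsto_pi_nhds]
      rintro ⟨x, z⟩
      have h2 := (h.differentiable i z x).hasGradientAt.hasFDerivAt.lim e
        (c := fun m : ℕ => (m : ℝ)) (l := Filter.atTop)
        (by simpa using tendsto_natCast_atTop_atTop)
      simpa [sampleGradient, real_inner_comm] using h2
  have hsum : (fun p : Vec d × Ξ i => sampleGradient F i p.2 p.1) = fun p => ∑ j,
      inner ℝ (EuclideanSpace.basisFun (Fin d) ℝ j) (sampleGradient F i p.2 p.1) •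
        EuclideanSpace.basisFun (Fin d) ℝ j := by
    funext p
    exact ((EuclideanSpace.basisFun (Fin d) ℝ).sum_repr' _).symm
  rw [hsum]
  exact Finset.measurable_sum _ fun j _ => (hinner _).smul_const _

/-- The deviation of a stochastic gradient from its mean. -/
def gradientNoise (D : ∀ i, Measure (Ξ i)) (F : ∀ i, Vec d → Ξ i → ℝ) (i : Fin n) (y : Vec d)
    (z : Ξ i) : Vec d :=
  sampleGradient F i z y - gradient (localObjective D F i) y

theorem BoundedVariance.measurable_gradientNoise (h : BoundedVariance D F σ)
    (hL : AveragedSmooth D F L) (i : Fin n) :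
    Measurable fun p : Vec d × Ξ i => gradientNoise D F i p.1 p.2 :=
  (h.measurable_sampleGradient i).sub
    ((hL.continuous_local_gradient i.pos i).measurable.comp measurable_fst)

theorem BoundedVariance.integrable_gradientNoise [∀ i, IsProbabilityMeasure (D i)]
    (h : BoundedVariance D F σ) (i : Fin n) (y : Vec d) :
    Integrable (gradientNoise D F i y) (D i) :=
  (h.integrable_gradient i y).sub (integrable_const _)

theorem BoundedVariance.integral_gradientNoise [∀ i, IsProbabilityMeasure (D i)]
    (h : BoundedVariance D F σ) (i : Fin n) (y : Vec d) :
    ∫ z, gradientNoise D F i y z ∂(D i) = 0 := by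
  unfold gradientNoise
  rw [integral_sub (h.integrable_gradient i y) (integrable_const _), h.unbiased]
  simp

end Problem

/-! ### Orthogonality in L² -/

section SquareIntegrable

variable {Ω : Type v} [MeasurableSpace Ω] {P : Measure Ω} {E : Type*} [NormedAddCommGroup E]
  [InnerProductSpace ℝ E] {X Y : Ω → E}

omit [InnerProductSpace ℝ E] in
theorem integrable_norm_sq (hX : MemLp X 2 P) : Integrable (fun ω => ‖X ω‖ ^ 2) P :=
  (memLp_two_iff_integrable_sq_norm hX.1).1 hX

theorem integrable_inner (hX : MemLp X 2 P) (hY : MemLp Y 2 P) :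
    Integrable (fun ω => inner ℝ (X ω) (Y ω)) P := by
  refine ((integrable_norm_sq hX).add (integrable_norm_sq hY)).mono' (hX.1.inner hY.1)
    (Filter.Eventually.of_forall fun ω => ?_)
  have h := norm_inner_le_norm (𝕜 := ℝ) (X ω) (Y ω)
  simp only [Pi.add_apply]
  nlinarith [sq_nonneg (‖X ω‖ - ‖Y ω‖), sq_nonneg (‖X ω‖), sq_nonneg ‖Y ω‖]

theorem integral_norm_add_sq (hX : MemLp X 2 P) (hY : MemLp Y 2 P)
    (h : ∫ ω, inner ℝ (X ω) (Y ω) ∂P = 0) :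
    ∫ ω, ‖X ω + Y ω‖ ^ 2 ∂P = ∫ ω, ‖X ω‖ ^ 2 ∂P + ∫ ω, ‖Y ω‖ ^ 2 ∂P := by
  simp_rw [norm_add_sq_real]
  have h1 : Integrable (fun ω => ‖X ω‖ ^ 2 + 2 * inner ℝ (X ω) (Y ω)) P :=
    (integrable_norm_sq hX).add ((integrable_inner hX hY).const_mul 2)
  rw [integral_add h1 (integrable_norm_sq hY), integral_add (integrable_norm_sq hX)
    ((integrable_inner hX hY).const_mul 2), integral_const_mul, h]
  ring

theorem integral_norm_sum_sq_of_orthogonal {ι : Type*} (s : Finset ι) (V : ι → Ω → E)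
    (hV : ∀ e ∈ s, MemLp (V e) 2 P)
    (hort : ∀ e ∈ s, ∀ e' ∈ s, e' ≠ e → ∫ ω, inner ℝ (V e' ω) (V e ω) ∂P = 0) :
    ∫ ω, ‖∑ e ∈ s, V e ω‖ ^ 2 ∂P = ∑ e ∈ s, ∫ ω, ‖V e ω‖ ^ 2 ∂P := by
  classical
  induction s using Finset.induction_on with
  | empty => simp
  | insert a s ha ih =>
    have hs : ∀ e ∈ s, MemLp (V e) 2 P := fun e he => hV e (Finset.mem_insert_of_mem he)
    simp only [Finset.sum_insert ha]
    rw [integral_norm_add_sq (hV a (Finset.mem_insert_self _ _)) (memLp_finsetSum s hs), ih hs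
      fun e he e' he' => hort e (Finset.mem_insert_of_mem he) e' (Finset.mem_insert_of_mem he')]
    simp_rw [inner_sum]
    rw [integral_finsetSum _ fun e he => integrable_inner (hV a (Finset.mem_insert_self _ _))
      (hs e he)]
    exact Finset.sum_eq_zero fun e he => hort e (Finset.mem_insert_of_mem he) a
      (Finset.mem_insert_self _ _) fun h => ha (h ▸ he)

end SquareIntegrable

/-! ### Noise of a fresh sample at a random point -/

section Independence

variable {d : ℕ} {Ω : Type v} {m : MeasurableSpace Ω} [mΩ : MeasurableSpace Ω] {P : Measure Ω}
  [IsProbabilityMeasure P]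
  {Z : Type u} [MeasurableSpace Z] {ν : Measure Z} [IsProbabilityMeasure ν]
  {ζ : Ω → Z} {Φ : Vec d → Z → Vec d} {y h : Ω → Vec d} {s : ℝ}

omit [IsProbabilityMeasure ν] in
theorem map_prodMk_of_indep {A : Type*} [MeasurableSpace A] {W : Ω → A} (hm : m ≤ mΩ)
    (hζ : Measurable ζ) (hlaw : P.map ζ = ν)
    (hind : Indep m (MeasurableSpace.comap ζ inferInstance) P) (hW : Measurable[m] W) :
    P.map (fun ω => (W ω, ζ ω)) = (P.map W).prod ν := by
  have h1 : IndepFun W ζ P := by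
    rw [IndepFun_iff_Indep]
    exact indep_of_indep_of_le_left hind hW.comap_le
  rw [(indepFun_iff_map_prod_eq_prod_map_map (hW.mono hm le_rfl).aemeasurable
    hζ.aemeasurable).1 h1, hlaw]

/-- The pair (y, ζ) has a product law, so Fubini freezes the point y and the uniform bound applies
on each fiber. -/
theorem secondMoment_of_indep (hm : m ≤ mΩ) (hζ : Measurable ζ) (hlaw : P.map ζ = ν)
    (hind : Indep m (MeasurableSpace.comap ζ inferInstance) P) (hy : Measurable[m] y)
    (hΦ : Measurable fun p : Vec d × Z => Φ p.1 p.2)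
    (hint : ∀ w, Integrable (fun z => ‖Φ w z‖ ^ 2) ν) (hs : ∀ w, ∫ z, ‖Φ w z‖ ^ 2 ∂ν ≤ s) :
    MemLp (fun ω => Φ (y ω) (ζ ω)) 2 P ∧ ∫ ω, ‖Φ (y ω) (ζ ω)‖ ^ 2 ∂P ≤ s := by
  have hy' : Measurable y := hy.mono hm le_rfl
  have hmap := map_prodMk_of_indep hm hζ hlaw hind hy
  have : IsProbabilityMeasure (P.map y) := Measure.isProbabilityMeasure_map hy'.aemeasurable
  have hsm : StronglyMeasurable fun p : Vec d × Z => ‖Φ p.1 p.2‖ ^ 2 :=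
    (hΦ.norm.pow_const 2).stronglyMeasurable
  have hnn : ∀ w, 0 ≤ ∫ z, ‖Φ w z‖ ^ 2 ∂ν := fun w => integral_nonneg fun z => sq_nonneg _
  have hprod : Integrable (fun p : Vec d × Z => ‖Φ p.1 p.2‖ ^ 2) ((P.map y).prod ν) := by
    rw [integrable_prod_iff hsm.aestronglyMeasurable]
    refine ⟨Filter.Eventually.of_forall fun w => hint w, ?_⟩
    refine (integrable_const s).mono' ?_ (Filter.Eventually.of_forall fun w => ?_)
    · exact hsm.norm.integral_prod_right.aestronglyMeasurable
    · simp only [norm_pow, norm_norm]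
      rw [Real.norm_of_nonneg (hnn w)]
      exact hs w
  have hpair : Measurable fun ω => (y ω, ζ ω) := hy'.prodMk hζ
  have hcomp : Integrable (fun ω => ‖Φ (y ω) (ζ ω)‖ ^ 2) P := by
    rw [← hmap] at hprod
    exact hprod.comp_measurable hpair
  refine ⟨(memLp_two_iff_integrable_sq_norm (hΦ.comp hpair).aestronglyMeasurable).2 hcomp, ?_⟩
  have h1 : ∫ ω, ‖Φ (y ω) (ζ ω)‖ ^ 2 ∂P =
      ∫ p, ‖Φ p.1 p.2‖ ^ 2 ∂(P.map fun ω => (y ω, ζ ω)) :=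
    (integral_map hpair.aemeasurable hsm.aestronglyMeasurable).symm
  rw [h1, hmap, integral_prod _ hprod]
  calc ∫ w, ∫ z, ‖Φ w z‖ ^ 2 ∂ν ∂(P.map y) ≤ ∫ _, s ∂(P.map y) :=
        integral_mono hprod.integral_prod_left (integrable_const s) hs
    _ = s := by simp

/-- With both h and y frozen, the inner integral is the inner product of h with the mean of Φ, which
is zero. This plays the role of a conditional expectation. -/
theorem integral_inner_of_indep (hm : m ≤ mΩ) (hζ : Measurable ζ) (hlaw : P.map ζ = ν)
    (hind : Indep m (MeasurableSpace.comap ζ inferInstance) P) (hy : Measurable[m] y)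
    (hh : Measurable[m] h) (hh2 : MemLp h 2 P)
    (hΦ : Measurable fun p : Vec d × Z => Φ p.1 p.2)
    (hΦ2 : MemLp (fun ω => Φ (y ω) (ζ ω)) 2 P) (hint : ∀ w, Integrable (Φ w) ν)
    (hzero : ∀ w, ∫ z, Φ w z ∂ν = 0) :
    ∫ ω, inner ℝ (h ω) (Φ (y ω) (ζ ω)) ∂P = 0 := by
  have hW : Measurable[m] fun ω => (h ω, y ω) := hh.prodMk hy
  have hmap := map_prodMk_of_indep hm hζ hlaw hind hW
  have hpair : Measurable fun ω => ((h ω, y ω), ζ ω) := (hW.mono hm le_rfl).prodMk hζ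
  have : IsProbabilityMeasure (P.map fun ω => (h ω, y ω)) :=
    Measure.isProbabilityMeasure_map (hW.mono hm le_rfl).aemeasurable
  have hmeas : Measurable fun p : (Vec d × Vec d) × Z => inner ℝ p.1.1 (Φ p.1.2 p.2) :=
    measurable_fst.fst.inner (hΦ.comp (measurable_fst.snd.prodMk measurable_snd))
  have h1 : ∫ ω, inner ℝ (h ω) (Φ (y ω) (ζ ω)) ∂P =
      ∫ p, inner ℝ p.1.1 (Φ p.1.2 p.2) ∂(P.map fun ω => ((h ω, y ω), ζ ω)) :=
    (integral_map hpair.aemeasurable hmeas.aestronglyMeasurable).symm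
  have h2 : Integrable (fun p : (Vec d × Vec d) × Z => inner ℝ p.1.1 (Φ p.1.2 p.2))
      (P.map fun ω => ((h ω, y ω), ζ ω)) :=
    (integrable_map_measure hmeas.aestronglyMeasurable hpair.aemeasurable).2
      (integrable_inner hh2 hΦ2)
  rw [hmap] at h2
  rw [h1, hmap, integral_prod _ h2]
  simp only
  rw [integral_eq_zero_of_ae]
  refine Filter.Eventually.of_forall fun w => ?_
  simp only [Pi.zero_apply]
  rw [integral_inner (hint _), hzero, inner_zero_right]

end Independence

/-! ### Stability of L² and of measurability -/

section Lipschitz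

theorem memLp_comp_of_lipschitz {Ω : Type v} [MeasurableSpace Ω] {P : Measure Ω}
    [IsFiniteMeasure P] {E : Type*} [NormedAddCommGroup E] {X : Ω → E} {g : E → E} {C : ℝ}
    (hg : ∀ x y, ‖g x - g y‖ ≤ C * ‖x - y‖) (hc : Continuous g) (hX : MemLp X 2 P) :
    MemLp (fun ω => g (X ω)) 2 P := by
  have h1 : MemLp (fun ω => g (X ω) - g 0) 2 P := by
    refine hX.of_le_mul (c := C)
      ((hc.comp_aestronglyMeasurable hX.1).sub aestronglyMeasurable_const)
      (Filter.Eventually.of_forall fun ω => ?_)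
    simpa using hg (X ω) 0
  exact (h1.add (memLp_const (g 0))).congr_norm
    (hc.comp_aestronglyMeasurable hX.1) (Filter.Eventually.of_forall fun ω => by simp)

theorem memLp_fun_smul {Ω : Type v} [MeasurableSpace Ω] {P : Measure Ω} {E : Type*}
    [NormedAddCommGroup E] [NormedSpace ℝ E] {X : Ω → E} (c : ℝ) (hX : MemLp X 2 P) :
    MemLp (fun ω => c • X ω) 2 P :=
  hX.const_smul c

theorem measurable_fun_smul {Ω : Type v} {m : MeasurableSpace Ω} {d : ℕ} {X : Ω → Vec d} (c : ℝ)
    (hX : Measurable[m] X) : Measurable[m] (fun ω => c • X ω) :=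
  hX.const_smul c

end Lipschitz

/-! ### σ-algebras generated by sets of samples -/

section SampleField

variable {n : ℕ} {Ξ : Fin n → Type u} [∀ i, MeasurableSpace (Ξ i)] {Ω : Type v}

/-- The σ-algebra generated by the data points with indices in `S`. -/
abbrev sampleField (ξ : ∀ i : Fin n, ℕ → Ω → Ξ i) (S : Set ((_ : Fin n) × ℕ)) : MeasurableSpace Ω :=
  ⨆ e ∈ S, MeasurableSpace.comap (ξ e.1 e.2) inferInstance

variable {ξ : ∀ i : Fin n, ℕ → Ω → Ξ i}

theorem sampleField_mono {S T : Set ((_ : Fin n) × ℕ)} (h : S ⊆ T) :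
    sampleField ξ S ≤ sampleField ξ T :=
  biSup_mono h

theorem measurable_sample {S : Set ((_ : Fin n) × ℕ)} {e : (_ : Fin n) × ℕ} (he : e ∈ S) :
    Measurable[sampleField ξ S] (ξ e.1 e.2) :=
  measurable_iff_comap_le.2
    (le_biSup (fun e : (_ : Fin n) × ℕ => MeasurableSpace.comap (ξ e.1 e.2) inferInstance) he)

variable [mΩ : MeasurableSpace Ω] {P : Measure Ω} {D : ∀ i, Measure (Ξ i)}

theorem IndepSamples.sampleField_le (h : IndepSamples D P ξ) (S : Set ((_ : Fin n) × ℕ)) :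
    sampleField ξ S ≤ mΩ :=
  iSup₂_le fun e _ => (h.measurable e.1 e.2).comap_le

theorem IndepSamples.indep_sampleField (h : IndepSamples D P ξ) {S : Set ((_ : Fin n) × ℕ)}
    {e : (_ : Fin n) × ℕ} (he : e ∉ S) :
    Indep (sampleField ξ S) (MeasurableSpace.comap (ξ e.1 e.2) inferInstance) P := by
  have h1 := indep_iSup_of_disjoint (fun e : (_ : Fin n) × ℕ => (h.measurable e.1 e.2).comap_le) h.indep.iIndep
    (Set.disjoint_singleton_right.2 he)
  simpa [sampleField] using h1

end SampleField

/-! ### The random iteration: measurability, moments, and noise -/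

section Iteration

variable {n d : ℕ} {τ : Fin n → ℝ} {Ξ : Fin n → Type u} [∀ i, MeasurableSpace (Ξ i)]
  {Ω : Type v} [mΩ : MeasurableSpace Ω]

/-- The standing assumptions on computation times, problem and data points. -/
structure Setting (τ : Fin n → ℝ) (D : ∀ i, Measure (Ξ i)) (F : ∀ i, Vec d → Ξ i → ℝ) (L σ : ℝ)
    (P : Measure Ω) (ξ : ∀ i : Fin n, ℕ → Ω → Ξ i) : Prop where
  times : ∀ i, 0 < τ i
  variance : BoundedVariance D F σ
  smooth : AveragedSmooth D F L
  samples : IndepSamples D P ξ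

variable (o : ArrivalOrder n τ) (D : ∀ i, Measure (Ξ i)) (F : ∀ i, Vec d → Ξ i → ℝ)
  (ξ : ∀ i : Fin n, ℕ → Ω → Ξ i) (γ : ℝ) (x₀ : Vec d)

omit mΩ in
/-- The point at which worker `i` computes its gradients for the table of round `r`. -/
def stalePoint (r : ℕ) (i : Fin n) (ω : Ω) : Vec d :=
  ringleader o F ξ γ x₀ (modelIndex o r i) ω

/-- The mean of the local gradients at the points used in round `r`. -/
def meanGradient (r : ℕ) (ω : Ω) : Vec d :=
  (1 / (n : ℝ)) • ∑ i, gradient (localObjective D F i) (stalePoint o F ξ γ x₀ r i ω)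

/-- The noise in the gradient number `e.2` of worker `e.1`, used in the step from `xᵏ`. -/
def sampleNoise (k : ℕ) (e : (_ : Fin n) × ℕ) (ω : Ω) : Vec d :=
  gradientNoise D F e.1 (stalePoint o F ξ γ x₀ (k / n) e.1 ω) (ξ e.1 e.2 ω)

/-- The noise in the step from `xᵏ` to `xᵏ⁺¹`. -/
def stepNoise (k : ℕ) (ω : Ω) : Vec d :=
  ∑ e ∈ Finset.univ.sigma (table o k),
    (1 / ((n : ℝ) * batch o k e.1)) • sampleNoise o D F ξ γ x₀ k e ω

/-- The data points used in the steps before `xᵏ`. -/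
def used (k : ℕ) : Set ((_ : Fin n) × ℕ) := {e | ∃ k' < k, e.2 ∈ table o k' e.1}

variable {o D F ξ γ x₀} {L σ : ℝ} {P : Measure Ω}

theorem used_mono {k k' : ℕ} (h : k ≤ k') : used o k ⊆ used o k' := by
  rintro e ⟨j, hj, he⟩
  exact ⟨j, hj.trans_le h, he⟩

/-- Steps of one round reuse samples, so a sample is fresh only relative to the start `k / n * n` of
the round, not relative to `k`. -/
theorem not_mem_used {k : ℕ} {e : (_ : Fin n) × ℕ} (he : e.2 ∈ table o k e.1) :
    e ∉ used o (k / n * n) := by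
  rintro ⟨k', hk', he'⟩
  have h1 := div_eq_div_of_mem_table he he'
  have h2 := (Nat.div_lt_iff_lt_mul (card_pos o)).2 hk'
  omega

theorem modelIndex_le (hτ : ∀ i, 0 < τ i) (r : ℕ) (i : Fin n) : modelIndex o r i ≤ r * n := by
  rcases r with _ | r
  · rw [modelIndex_zero]; exact Nat.zero_le _
  · exact (modelIndex_succ_mem hτ r i).2

omit mΩ [∀ i, MeasurableSpace (Ξ i)] in
theorem ringleader_zero (ω : Ω) : ringleader o F ξ γ x₀ 0 ω = x₀ := iterate_zero _ _ _

omit mΩ in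
theorem ringleader_succ (hτ : ∀ i, 0 < τ i) (k : ℕ) (ω : Ω) :
    ringleader o F ξ γ x₀ (k + 1) ω = ringleader o F ξ γ x₀ k ω -
      γ • (meanGradient o D F ξ γ x₀ (k / n) ω + stepNoise o D F ξ γ x₀ k ω) := by
  rw [ringleader, iterate_succ _ _ _ hτ]
  refine congrArg (fun w => ringleader o F ξ γ x₀ k ω - γ • w) ?_
  rw [meanGradient, stepNoise, Finset.sum_sigma, Finset.smul_sum, Finset.smul_sum,
    ← Finset.sum_add_distrib]
  refine Finset.sum_congr rfl fun i _ => ?_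
  have hb : (batch o k i : ℝ) ≠ 0 := by exact_mod_cast (batch_pos hτ k i).ne'
  have hn : (n : ℝ) ≠ 0 := by exact_mod_cast (card_pos o).ne'
  simp only [sampleNoise, gradientNoise]
  rw [← Finset.smul_sum, Finset.sum_sub_distrib, Finset.sum_const, card_table hτ,
    ← Nat.cast_smul_eq_nsmul ℝ, smul_sub, smul_smul, smul_smul,
    show 1 / ((n : ℝ) * batch o k i) * batch o k i = 1 / n by field_simp,
    show 1 / (n : ℝ) * (1 / batch o k i) = 1 / (n * batch o k i) by field_simp]
  rw [add_sub_cancel]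
  rfl

namespace Setting

variable (H : Setting τ D F L σ P ξ)
include H

theorem measurable_ringleader (k : ℕ) :
    Measurable[sampleField ξ (used o k)] (ringleader o F ξ γ x₀ k) := by
  induction k using Nat.strong_induction_on with
  | _ k ih =>
    rcases k with _ | k
    · have : ringleader o F ξ γ x₀ 0 = fun _ => x₀ := funext ringleader_zero
      rw [this]
      exact measurable_const
    · have hle : ∀ j ≤ k, Measurable[sampleField ξ (used o (k + 1))] (ringleader o F ξ γ x₀ j) :=
        fun j hj => (ih j (Nat.lt_succ_of_le hj)).mono
          (sampleField_mono (used_mono (Nat.le_succ_of_le hj))) le_rfl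
      have hst : ∀ i, Measurable[sampleField ξ (used o (k + 1))]
          (stalePoint o F ξ γ x₀ (k / n) i) := fun i =>
        hle _ ((modelIndex_le H.times _ _).trans (Nat.div_mul_le_self k n))
      have heq : ringleader o F ξ γ x₀ (k + 1) = fun ω => ringleader o F ξ γ x₀ k ω -
          γ • (meanGradient o D F ξ γ x₀ (k / n) ω + stepNoise o D F ξ γ x₀ k ω) :=
        funext (ringleader_succ H.times k)
      rw [heq]
      refine (hle k le_rfl).sub (measurable_fun_smul γ (Measurable.add ?_ ?_))
      · exact measurable_fun_smul _ (Finset.measurable_sum _ fun i _ =>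
          (H.smooth.continuous_local_gradient (card_pos o) i).measurable.comp (hst i))
      · refine Finset.measurable_sum _ fun e he => measurable_fun_smul _ ?_
        have hs : Measurable[sampleField ξ (used o (k + 1))] (ξ e.1 e.2) :=
          measurable_sample ⟨k, Nat.lt_succ_self k, (Finset.mem_sigma.1 he).2⟩
        exact (H.variance.measurable_gradientNoise H.smooth e.1).comp ((hst e.1).prodMk hs)

theorem measurable_stalePoint (r : ℕ) (i : Fin n) :
    Measurable[sampleField ξ (used o (r * n))] (stalePoint o F ξ γ x₀ r i) :=
  (H.measurable_ringleader _).mono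
    (sampleField_mono (used_mono (modelIndex_le H.times r i))) le_rfl

theorem measurable_meanGradient (r : ℕ) :
    Measurable[sampleField ξ (used o (r * n))] (meanGradient o D F ξ γ x₀ r) :=
  measurable_fun_smul _ (Finset.measurable_sum _ fun i _ =>
    (H.smooth.continuous_local_gradient (card_pos o) i).measurable.comp
      (H.measurable_stalePoint r i))

variable [∀ i, IsProbabilityMeasure (D i)] [IsProbabilityMeasure P]

theorem secondMoment_sampleNoise {k : ℕ} {e : (_ : Fin n) × ℕ} (he : e.2 ∈ table o k e.1) :
    MemLp (sampleNoise o D F ξ γ x₀ k e) 2 P ∧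
      ∫ ω, ‖sampleNoise o D F ξ γ x₀ k e ω‖ ^ 2 ∂P ≤ σ ^ 2 :=
  secondMoment_of_indep (Φ := gradientNoise D F e.1) (ζ := ξ e.1 e.2)
    (H.samples.sampleField_le (used o (k / n * n)))
    (H.samples.measurable _ _) (H.samples.law _ _)
    (H.samples.indep_sampleField (not_mem_used he)) (H.measurable_stalePoint _ _)
    (H.variance.measurable_gradientNoise H.smooth _) (H.variance.integrable_sq _)
    (H.variance.variance_le _)

theorem integral_inner_sampleNoise {k : ℕ} {e : (_ : Fin n) × ℕ} (he : e.2 ∈ table o k e.1)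
    {S : Set ((_ : Fin n) × ℕ)} (hS : used o (k / n * n) ⊆ S) (heS : e ∉ S) {h : Ω → Vec d}
    (hh : Measurable[sampleField ξ S] h) (hh2 : MemLp h 2 P) :
    ∫ ω, inner ℝ (h ω) (sampleNoise o D F ξ γ x₀ k e ω) ∂P = 0 :=
  integral_inner_of_indep (Φ := gradientNoise D F e.1) (ζ := ξ e.1 e.2)
    (H.samples.sampleField_le S) (H.samples.measurable _ _) (H.samples.law _ _)
    (H.samples.indep_sampleField heS)
    ((H.measurable_stalePoint _ _).mono (sampleField_mono hS) le_rfl) hh hh2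
    (H.variance.measurable_gradientNoise H.smooth _) (H.secondMoment_sampleNoise he).1
    (H.variance.integrable_gradientNoise _) (H.variance.integral_gradientNoise _)

theorem memLp_stepNoise (k : ℕ) : MemLp (stepNoise o D F ξ γ x₀ k) 2 P :=
  memLp_finsetSum _ fun _ he =>
    memLp_fun_smul _ (H.secondMoment_sampleNoise (Finset.mem_sigma.1 he).2).1

/-- The noise of a step has mean zero given everything that precedes the round of this step. -/
theorem integral_inner_stepNoise (k : ℕ) {h : Ω → Vec d}
    (hh : Measurable[sampleField ξ (used o (k / n * n))] h) (hh2 : MemLp h 2 P) :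
    ∫ ω, inner ℝ (h ω) (stepNoise o D F ξ γ x₀ k ω) ∂P = 0 := by
  simp only [stepNoise, inner_sum, inner_smul_right]
  rw [integral_finsetSum _ fun e he => (integrable_inner hh2
    (H.secondMoment_sampleNoise (Finset.mem_sigma.1 he).2).1).const_mul _]
  refine Finset.sum_eq_zero fun e he => ?_
  have he' := (Finset.mem_sigma.1 he).2
  rw [integral_const_mul, H.integral_inner_sampleNoise he' le_rfl (not_mem_used he') hh hh2,
    mul_zero]

/-- Given the earlier rounds and the sample `e'`, the noise of `e'` is known while `e` is still
fresh. -/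
theorem integral_sampleNoise_orthogonal {k : ℕ} {e e' : (_ : Fin n) × ℕ}
    (he : e.2 ∈ table o k e.1) (he' : e'.2 ∈ table o k e'.1) (hne : e' ≠ e) :
    ∫ ω, inner ℝ (sampleNoise o D F ξ γ x₀ k e' ω) (sampleNoise o D F ξ γ x₀ k e ω) ∂P = 0 := by
  refine H.integral_inner_sampleNoise (S := insert e' (used o (k / n * n))) he
    (Set.subset_insert _ _) ?_ ?_ (H.secondMoment_sampleNoise he').1
  · rw [Set.mem_insert_iff, not_or]
    exact ⟨hne.symm, not_mem_used he⟩
  · have h1 : Measurable[sampleField ξ (insert e' (used o (k / n * n)))] (ξ e'.1 e'.2) :=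
      measurable_sample (Set.mem_insert _ _)
    exact (H.variance.measurable_gradientNoise H.smooth e'.1).comp
      (((H.measurable_stalePoint (k / n) e'.1).mono
        (sampleField_mono (Set.subset_insert _ _)) le_rfl).prodMk h1)

/-- By orthogonality the variances add: worker i contributes at most b_i · σ²/(n b_i)², and these
sum to σ²/(n B^k). -/
theorem secondMoment_stepNoise (k : ℕ) :
    ∫ ω, ‖stepNoise o D F ξ γ x₀ k ω‖ ^ 2 ∂P ≤ σ ^ 2 / (n * minBatch o) := by
  have hn : (0 : ℝ) < n := by exact_mod_cast card_pos o
  simp only [stepNoise]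
  rw [integral_norm_sum_sq_of_orthogonal _
    (fun e ω => (1 / ((n : ℝ) * batch o k e.1)) • sampleNoise o D F ξ γ x₀ k e ω)
    (fun e he => memLp_fun_smul _ (H.secondMoment_sampleNoise (Finset.mem_sigma.1 he).2).1)
    (fun e he e' he' hne => by
      simp only [inner_smul_left, inner_smul_right]
      rw [integral_const_mul, integral_const_mul, H.integral_sampleNoise_orthogonal
        (Finset.mem_sigma.1 he).2 (Finset.mem_sigma.1 he').2 hne, mul_zero, mul_zero])]
  have h1 : ∀ e ∈ Finset.univ.sigma (table o k),
      ∫ ω, ‖(1 / ((n : ℝ) * batch o k e.1)) • sampleNoise o D F ξ γ x₀ k e ω‖ ^ 2 ∂P ≤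
        (1 / ((n : ℝ) * batch o k e.1)) ^ 2 * σ ^ 2 := fun e he => by
    simp only [norm_smul, mul_pow, Real.norm_eq_abs, sq_abs]
    rw [integral_const_mul]
    exact mul_le_mul_of_nonneg_left (H.secondMoment_sampleNoise (Finset.mem_sigma.1 he).2).2
      (sq_nonneg _)
  refine (Finset.sum_le_sum h1).trans ?_
  rw [Finset.sum_sigma]
  have h2 : ∀ i, ∑ _l ∈ table o k i, (1 / ((n : ℝ) * batch o k i)) ^ 2 * σ ^ 2 =
      σ ^ 2 / n * ((1 / n) * (1 / batch o k i)) := fun i => by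
    have hb : (batch o k i : ℝ) ≠ 0 := by exact_mod_cast (batch_pos H.times k i).ne'
    rw [Finset.sum_const, card_table H.times, nsmul_eq_mul]
    field_simp
  simp only [h2]
  rw [← Finset.mul_sum, ← Finset.mul_sum]
  refine (mul_le_mul_of_nonneg_left (mean_one_div_batch_le H.times k) (by positivity)).trans_eq ?_
  field_simp

omit [∀ i, IsProbabilityMeasure (D i)] in
theorem memLp_meanGradient_of (r : ℕ) (h : ∀ i, MemLp (stalePoint o F ξ γ x₀ r i) 2 P) :
    MemLp (meanGradient o D F ξ γ x₀ r) 2 P :=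
  memLp_fun_smul _ (memLp_finsetSum _ fun i _ =>
    memLp_comp_of_lipschitz (H.smooth.local_gradient_lipschitz (card_pos o) i)
      (H.smooth.continuous_local_gradient (card_pos o) i) (h i))

theorem memLp_ringleader (k : ℕ) : MemLp (ringleader o F ξ γ x₀ k) 2 P := by
  induction k using Nat.strong_induction_on with
  | _ k ih =>
    rcases k with _ | k
    · have : ringleader o F ξ γ x₀ 0 = fun _ => x₀ := funext ringleader_zero
      rw [this]
      exact memLp_const x₀
    · have heq : ringleader o F ξ γ x₀ (k + 1) = fun ω => ringleader o F ξ γ x₀ k ω -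
          γ • (meanGradient o D F ξ γ x₀ (k / n) ω + stepNoise o D F ξ γ x₀ k ω) :=
        funext (ringleader_succ H.times k)
      have hM := H.memLp_meanGradient_of (o := o) (γ := γ) (x₀ := x₀) (k / n) fun i =>
        ih _ (Nat.lt_succ_of_le ((modelIndex_le H.times _ _).trans (Nat.div_mul_le_self k n)))
      rw [heq]
      exact (ih k (Nat.lt_succ_self k)).sub (memLp_fun_smul γ (hM.add (H.memLp_stepNoise k)))

theorem memLp_meanGradient (r : ℕ) : MemLp (meanGradient o D F ξ γ x₀ r) 2 P :=
  H.memLp_meanGradient_of r fun _ => H.memLp_ringleader _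

omit [∀ i, IsProbabilityMeasure (D i)] in
theorem memLp_gradient {X : Ω → Vec d} (hn : 0 < n) (hX : MemLp X 2 P) :
    MemLp (fun ω => gradient (objective D F) (X ω)) 2 P :=
  memLp_comp_of_lipschitz (H.smooth.gradient_lipschitz hn) (H.smooth.continuous_gradient hn) hX

-- The two-sided quadratic bound keeps f within (L/2)‖X‖² of its linearization at 0.
omit [∀ i, IsProbabilityMeasure (D i)] in
theorem integrable_objective {X : Ω → Vec d} (hn : 0 < n) (hX : MemLp X 2 P) :
    Integrable (fun ω => objective D F (X ω)) P := by
  have hd := H.smooth.differentiable_objective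
  have hl := H.smooth.gradient_lipschitz hn
  have h1 : Integrable (fun ω => objective D F 0 +
      inner ℝ (gradient (objective D F) 0) (X ω)) P :=
    (integrable_const _).add (integrable_inner (memLp_const _) hX)
  have h2 : Integrable (fun ω => objective D F (X ω) - (objective D F 0 +
      inner ℝ (gradient (objective D F) 0) (X ω))) P := by
    refine ((integrable_norm_sq hX).const_mul (L / 2)).mono'
      ((hd.continuous.comp_aestronglyMeasurable hX.1).sub h1.1)
      (Filter.Eventually.of_forall fun ω => ?_)
    have h3 := le_add_inner_gradient hd hl 0 (X ω)
    have h4 := add_inner_gradient_le hd hl 0 (X ω)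
    rw [sub_zero] at h3 h4
    rw [Real.norm_eq_abs, abs_le]
    constructor <;> linarith
  refine (h2.add h1).congr (Filter.Eventually.of_forall fun ω => ?_)
  simp only [Pi.add_apply]
  ring

end Setting

end Iteration

theorem norm_sum_sq_le_card_mul {E ι : Type*} [SeminormedAddCommGroup E] (s : Finset ι)
    (V : ι → E) : ‖∑ j ∈ s, V j‖ ^ 2 ≤ s.card * ∑ j ∈ s, ‖V j‖ ^ 2 :=
  (pow_le_pow_left₀ (norm_nonneg _) (norm_sum_le s V) 2).trans sq_sum_le_card_mul_sum_sq

theorem sum_Ico_div (n r : ℕ) (φ : ℕ → ℝ) :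
    ∑ j ∈ Finset.Ico (r * n) ((r + 1) * n), φ (j / n) = n * φ r := by
  have h : ∀ j ∈ Finset.Ico (r * n) ((r + 1) * n), φ (j / n) = φ r := fun j hj => by
    rw [Finset.mem_Ico] at hj
    rw [Nat.div_eq_of_lt_le hj.1 hj.2]
  rw [Finset.sum_congr rfl h, Finset.sum_const, Nat.card_Ico, nsmul_eq_mul, Nat.add_mul,
    Nat.one_mul, Nat.add_sub_cancel_left]

/-! ### Staleness and descent -/

section Convergence

variable {n d : ℕ} {τ : Fin n → ℝ} {Ξ : Fin n → Type u} [∀ i, MeasurableSpace (Ξ i)]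
  {Ω : Type v} [mΩ : MeasurableSpace Ω]

variable (o : ArrivalOrder n τ) (D : ∀ i, Measure (Ξ i)) (F : ∀ i, Vec d → Ξ i → ℝ)
  (ξ : ∀ i : Fin n, ℕ → Ω → Ξ i) (γ : ℝ) (x₀ : Vec d) (P : Measure Ω)

/-- The second moment of the mean of the local gradients used in round `r`. -/
def meanSq (r : ℕ) : ℝ := ∫ ω, ‖meanGradient o D F ξ γ x₀ r ω‖ ^ 2 ∂P

/-- The second moment of the mean of the local gradients used in the round before round `r`. -/
def prevMeanSq : ℕ → ℝ
  | 0 => 0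
  | r + 1 => meanSq o D F ξ γ x₀ P r

/-- The bound `σ² / (nB)` for the second moment of the noise of a step. -/
def noiseBound (o : ArrivalOrder n τ) (σ : ℝ) : ℝ := σ ^ 2 / (n * minBatch o)

variable {o D F ξ γ x₀ P} {L σ : ℝ}

theorem meanSq_nonneg (r : ℕ) : 0 ≤ meanSq o D F ξ γ x₀ P r :=
  integral_nonneg fun _ => sq_nonneg _

theorem prevMeanSq_nonneg (r : ℕ) : 0 ≤ prevMeanSq o D F ξ γ x₀ P r := by
  cases r with
  | zero => exact le_rfl
  | succ r => exact meanSq_nonneg r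

theorem noiseBound_nonneg (hτ : ∀ i, 0 < τ i) : 0 ≤ noiseBound o σ :=
  div_nonneg (sq_nonneg _) (mul_nonneg n.cast_nonneg (minBatch_pos hτ).le)

omit mΩ in
theorem ringleader_sub (hτ : ∀ i, 0 < τ i) {q k : ℕ} (hqk : q ≤ k) (ω : Ω) :
    ringleader o F ξ γ x₀ k ω - ringleader o F ξ γ x₀ q ω =
      -(γ • ∑ j ∈ Finset.Ico q k,
        (meanGradient o D F ξ γ x₀ (j / n) ω + stepNoise o D F ξ γ x₀ j ω)) := by
  induction k, hqk using Nat.le_induction with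
  | base => simp
  | succ k hk ih =>
    rw [Finset.sum_Ico_succ_top hk, ringleader_succ (D := D) hτ, sub_right_comm, ih,
      smul_add γ (Finset.sum _ _)]
    abel

namespace Setting

variable (H : Setting τ D F L σ P ξ) [∀ i, IsProbabilityMeasure (D i)] [IsProbabilityMeasure P]
include H

theorem integral_norm_mean_add_noise_sq (k : ℕ) :
    ∫ ω, ‖meanGradient o D F ξ γ x₀ (k / n) ω + stepNoise o D F ξ γ x₀ k ω‖ ^ 2 ∂P ≤
      meanSq o D F ξ γ x₀ P (k / n) + noiseBound o σ := by
  rw [integral_norm_add_sq (H.memLp_meanGradient _) (H.memLp_stepNoise _)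
    (H.integral_inner_stepNoise k (H.measurable_meanGradient _) (H.memLp_meanGradient _))]
  exact add_le_add le_rfl (H.secondMoment_stepNoise k)

theorem integral_norm_ringleader_sub_sq {q k : ℕ} (hqk : q ≤ k) :
    ∫ ω, ‖ringleader o F ξ γ x₀ k ω - ringleader o F ξ γ x₀ q ω‖ ^ 2 ∂P ≤
      γ ^ 2 * ((k - q : ℕ) * ∑ j ∈ Finset.Ico q k,
        (meanSq o D F ξ γ x₀ P (j / n) + noiseBound o σ)) := by
  have hint : ∀ j, Integrable (fun ω =>
      ‖meanGradient o D F ξ γ x₀ (j / n) ω + stepNoise o D F ξ γ x₀ j ω‖ ^ 2) P := fun j =>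
    integrable_norm_sq ((H.memLp_meanGradient _).add (H.memLp_stepNoise _))
  calc ∫ ω, ‖ringleader o F ξ γ x₀ k ω - ringleader o F ξ γ x₀ q ω‖ ^ 2 ∂P
      ≤ ∫ ω, γ ^ 2 * ((k - q : ℕ) * ∑ j ∈ Finset.Ico q k,
          ‖meanGradient o D F ξ γ x₀ (j / n) ω + stepNoise o D F ξ γ x₀ j ω‖ ^ 2) ∂P := by
        refine integral_mono
          (integrable_norm_sq ((H.memLp_ringleader k).sub (H.memLp_ringleader q)))
          (((integrable_finsetSum _ fun j _ => hint j).const_mul _).const_mul _) fun ω => ?_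
        simp only
        rw [ringleader_sub (D := D) H.times hqk, norm_neg, norm_smul, mul_pow, Real.norm_eq_abs,
          sq_abs, ← Nat.card_Ico q k]
        exact mul_le_mul_of_nonneg_left (norm_sum_sq_le_card_mul _ _) (sq_nonneg _)
    _ = γ ^ 2 * ((k - q : ℕ) * ∑ j ∈ Finset.Ico q k, ∫ ω,
          ‖meanGradient o D F ξ γ x₀ (j / n) ω + stepNoise o D F ξ γ x₀ j ω‖ ^ 2 ∂P) := by
        rw [integral_const_mul, integral_const_mul, integral_finsetSum _ fun j _ => hint j]
    _ ≤ _ := by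
        gcongr
        exact H.integral_norm_mean_add_noise_sq _

/-- At most 2n steps lie between the two points, all in the current or the previous round, where the
moment of M is constant per round. Extending the sum to full rounds gives the factor n. -/
theorem integral_staleness (k : ℕ) (i : Fin n) :
    ∫ ω, ‖ringleader o F ξ γ x₀ k ω - stalePoint o F ξ γ x₀ (k / n) i ω‖ ^ 2 ∂P ≤
      2 * (γ * n) ^ 2 * (prevMeanSq o D F ξ γ x₀ P (k / n) + meanSq o D F ξ γ x₀ P (k / n) +
        2 * noiseBound o σ) := by
  have hn := card_pos o
  have hv := noiseBound_nonneg (o := o) (σ := σ) H.times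
  have hle : modelIndex o (k / n) i ≤ k :=
    (modelIndex_le H.times _ _).trans (Nat.div_mul_le_self k n)
  refine (H.integral_norm_ringleader_sub_sq hle).trans ?_
  set φ : ℕ → ℝ := fun r => meanSq o D F ξ γ x₀ P r + noiseBound o σ with hφ
  have hφ0 : ∀ r, 0 ≤ φ r := fun r => add_nonneg (meanSq_nonneg r) hv
  have hk : k < (k / n + 1) * n := Nat.lt_mul_of_div_lt (Nat.lt_succ_self _) hn
  have key : ((k - modelIndex o (k / n) i : ℕ) : ℝ) ≤ 2 * n ∧
      ∑ j ∈ Finset.Ico (modelIndex o (k / n) i) k, φ (j / n) ≤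
        n * (prevMeanSq o D F ξ γ x₀ P (k / n) + meanSq o D F ξ γ x₀ P (k / n) +
          2 * noiseBound o σ) := by
    rcases hr : k / n with _ | r
    -- In round 0 every worker still computes at x⁰, so the missing previous round counts as 0.
    · rw [hr, Nat.zero_add, Nat.one_mul] at hk
      rw [modelIndex_zero]
      constructor
      · have : ((k - 0 : ℕ) : ℝ) ≤ n := by exact_mod_cast hk.le
        linarith [(Nat.cast_nonneg n : (0 : ℝ) ≤ n)]
      · have h1 := sum_Ico_div n 0 φ
        have h2 : Finset.Ico 0 k ⊆ Finset.Ico (0 * n) ((0 + 1) * n) :=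
          Finset.Ico_subset_Ico (by simp) (by simpa using hk.le)
        refine (Finset.sum_le_sum_of_subset_of_nonneg h2 fun _ _ _ => hφ0 _).trans ?_
        rw [h1]
        refine mul_le_mul_of_nonneg_left ?_ n.cast_nonneg
        simp only [hφ, prevMeanSq]
        linarith
    · rw [hr] at hk
      have hm := modelIndex_succ_mem (o := o) H.times r i
      have hk' : k ≤ (r + 2) * n := hk.le
      constructor
      · have : k - modelIndex o (r + 1) i ≤ 2 * n := by
          rw [Nat.add_mul] at hk'
          omega
        exact_mod_cast this
      · have h1 := sum_Ico_div n r φ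
        have h1' := sum_Ico_div n (r + 1) φ
        have h2 : Finset.Ico (modelIndex o (r + 1) i) k ⊆
            Finset.Ico (r * n) ((r + 1 + 1) * n) := Finset.Ico_subset_Ico hm.1.le hk.le
        refine (Finset.sum_le_sum_of_subset_of_nonneg h2 fun _ _ _ => hφ0 _).trans ?_
        rw [← Finset.sum_Ico_consecutive _ (Nat.mul_le_mul_right n (Nat.le_succ r))
          (Nat.mul_le_mul_right n (Nat.le_succ (r + 1))), h1, h1', ← mul_add]
        refine mul_le_mul_of_nonneg_left ?_ n.cast_nonneg
        simp only [hφ, prevMeanSq]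
        linarith
  refine (mul_le_mul_of_nonneg_left (mul_le_mul key.1 key.2
    (Finset.sum_nonneg fun _ _ => hφ0 _) (by positivity)) (sq_nonneg γ)).trans_eq ?_
  ring

theorem integral_gradient_sub_mean_sq (k : ℕ) :
    ∫ ω, ‖gradient (objective D F) (ringleader o F ξ γ x₀ k ω) -
        meanGradient o D F ξ γ x₀ (k / n) ω‖ ^ 2 ∂P ≤
      2 * (γ * n * L) ^ 2 * (prevMeanSq o D F ξ γ x₀ P (k / n) +
        meanSq o D F ξ γ x₀ P (k / n) + 2 * noiseBound o σ) := by
  have hn := card_pos o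
  have hint : ∀ i, Integrable (fun ω =>
      ‖ringleader o F ξ γ x₀ k ω - stalePoint o F ξ γ x₀ (k / n) i ω‖ ^ 2) P := fun i =>
    integrable_norm_sq ((H.memLp_ringleader _).sub (H.memLp_ringleader _))
  calc ∫ ω, ‖gradient (objective D F) (ringleader o F ξ γ x₀ k ω) -
        meanGradient o D F ξ γ x₀ (k / n) ω‖ ^ 2 ∂P
      ≤ ∫ ω, L ^ 2 / n * ∑ i,
          ‖ringleader o F ξ γ x₀ k ω - stalePoint o F ξ γ x₀ (k / n) i ω‖ ^ 2 ∂P :=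
        integral_mono (integrable_norm_sq ((H.memLp_gradient hn (H.memLp_ringleader k)).sub
            (H.memLp_meanGradient _)))
          ((integrable_finsetSum _ fun i _ => hint i).const_mul _)
          fun ω => H.smooth.bound _ fun i => stalePoint o F ξ γ x₀ (k / n) i ω
    _ = L ^ 2 / n * ∑ i, ∫ ω,
          ‖ringleader o F ξ γ x₀ k ω - stalePoint o F ξ γ x₀ (k / n) i ω‖ ^ 2 ∂P := by
        rw [integral_const_mul, integral_finsetSum _ fun i _ => hint i]
    _ ≤ L ^ 2 / n * ∑ _i : Fin n, 2 * (γ * n) ^ 2 * (prevMeanSq o D F ξ γ x₀ P (k / n) +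
          meanSq o D F ξ γ x₀ P (k / n) + 2 * noiseBound o σ) := by
        gcongr with i
        exact H.integral_staleness k i
    _ = _ := by
        have hn' : (n : ℝ) ≠ 0 := by exact_mod_cast hn.ne'
        rw [Finset.sum_const, Finset.card_univ, Fintype.card_fin, nsmul_eq_mul]
        field_simp

/-- What `xᵏ` would be if the steps of its round had been made without noise. -/
theorem exists_noiseless (k : ℕ) : ∃ W : Ω → Vec d,
    Measurable[sampleField ξ (used o (k / n * n))] W ∧ MemLp W 2 P ∧
    ∀ ω, ringleader o F ξ γ x₀ k ω - W ω =
      -(γ • ∑ j ∈ Finset.Ico (k / n * n) k, stepNoise o D F ξ γ x₀ j ω) := by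
  refine ⟨fun ω => ringleader o F ξ γ x₀ (k / n * n) ω -
    γ • ((k - k / n * n : ℕ) : ℝ) • meanGradient o D F ξ γ x₀ (k / n) ω, ?_, ?_, fun ω => ?_⟩
  · exact (H.measurable_ringleader _).sub
      (measurable_fun_smul γ (measurable_fun_smul _ (H.measurable_meanGradient _)))
  · exact (H.memLp_ringleader _).sub
      (memLp_fun_smul γ (memLp_fun_smul _ (H.memLp_meanGradient _)))
  · have h := ringleader_sub (o := o) (D := D) (F := F) (ξ := ξ) (γ := γ) (x₀ := x₀) H.times
      (Nat.div_mul_le_self k n) ω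
    have h2 : ∀ j ∈ Finset.Ico (k / n * n) k,
        meanGradient o D F ξ γ x₀ (j / n) ω = meanGradient o D F ξ γ x₀ (k / n) ω := fun j hj => by
      rw [Finset.mem_Ico] at hj
      rw [Nat.div_eq_of_lt_le hj.1 (hj.2.trans
        (Nat.lt_mul_of_div_lt (Nat.lt_succ_self (k / n)) (card_pos o)))]
    rw [Finset.sum_add_distrib, Finset.sum_congr rfl h2, Finset.sum_const, Nat.card_Ico,
      ← Nat.cast_smul_eq_nsmul ℝ, smul_add] at h
    rw [← sub_add, h]
    abel

/-- The descent lemma, with -2⟨∇f, M⟩ = ‖∇f - M‖² - ‖∇f‖² - ‖M‖². The term ⟨∇f(x^k), N⟩ does not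
vanish in mean, because N shares samples with earlier steps of the round; each of these `k % n`
steps costs one multiple of the noise bound. -/
theorem integral_objective_succ_le (hγ : 0 ≤ γ) (k : ℕ) :
    ∫ ω, objective D F (ringleader o F ξ γ x₀ (k + 1) ω) ∂P +
        γ / 2 * ∫ ω, ‖gradient (objective D F) (ringleader o F ξ γ x₀ k ω)‖ ^ 2 ∂P ≤
      ∫ ω, objective D F (ringleader o F ξ γ x₀ k ω) ∂P
        - γ / 2 * meanSq o D F ξ γ x₀ P (k / n)
        + γ / 2 * ∫ ω, ‖gradient (objective D F) (ringleader o F ξ γ x₀ k ω) -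
            meanGradient o D F ξ γ x₀ (k / n) ω‖ ^ 2 ∂P
        + γ ^ 2 * L * ((k % n : ℕ) * noiseBound o σ)
        + L * γ ^ 2 / 2 * (meanSq o D F ξ γ x₀ P (k / n) + noiseBound o σ) := by
  have hn := card_pos o
  have hL := H.smooth.pos
  obtain ⟨W, hWm, hW2, hW⟩ := H.exists_noiseless (o := o) (γ := γ) (x₀ := x₀) k
  set X := ringleader o F ξ γ x₀ with hX
  set M := meanGradient o D F ξ γ x₀ (k / n) with hM
  set N := stepNoise o D F ξ γ x₀ with hN
  set s := Finset.Ico (k / n * n) k with hs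
  have hM2 : MemLp M 2 P := H.memLp_meanGradient _
  have hN2 : ∀ j, MemLp (N j) 2 P := fun j => H.memLp_stepNoise j
  have hX2 : ∀ j, MemLp (X j) 2 P := fun j => H.memLp_ringleader j
  have hg2 : MemLp (fun ω => gradient (objective D F) (X k ω)) 2 P := H.memLp_gradient hn (hX2 k)
  have hgW2 : MemLp (fun ω => gradient (objective D F) (W ω)) 2 P := H.memLp_gradient hn hW2
  have hzero : ∫ ω, inner ℝ (gradient (objective D F) (W ω)) (N k ω) ∂P = 0 :=
    H.integral_inner_stepNoise k
      ((H.smooth.continuous_gradient hn).measurable.comp hWm) hgW2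
  have i1 := H.integrable_objective hn (hX2 k)
  have i2 := (integrable_norm_sq hM2).const_mul (γ / 2)
  have i3 := (integrable_norm_sq (hg2.sub hM2)).const_mul (γ / 2)
  have i4 := (integrable_inner hgW2 (hN2 k)).const_mul γ
  have i5' : Integrable (fun ω => ∑ j ∈ s, (‖N j ω‖ ^ 2 + ‖N k ω‖ ^ 2)) P :=
    integrable_finsetSum _ fun j _ =>
      (integrable_norm_sq (hN2 j)).add (integrable_norm_sq (hN2 k))
  have i5 := i5'.const_mul (γ ^ 2 * L / 2)
  have i6 := (integrable_norm_sq (hM2.add (hN2 k))).const_mul (L * γ ^ 2 / 2)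
  have hpt : ∀ ω, objective D F (X (k + 1) ω) +
      γ / 2 * ‖gradient (objective D F) (X k ω)‖ ^ 2 ≤
      objective D F (X k ω) - γ / 2 * ‖M ω‖ ^ 2
        + γ / 2 * ‖gradient (objective D F) (X k ω) - M ω‖ ^ 2
        - γ * inner ℝ (gradient (objective D F) (W ω)) (N k ω)
        + γ ^ 2 * L / 2 * ∑ j ∈ s, (‖N j ω‖ ^ 2 + ‖N k ω‖ ^ 2)
        + L * γ ^ 2 / 2 * ‖M ω + N k ω‖ ^ 2 := fun ω => by
    have h1 := le_add_inner_gradient H.smooth.differentiable_objective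
      (H.smooth.gradient_lipschitz hn) (X k ω) (X (k + 1) ω)
    have h2 : X (k + 1) ω - X k ω = -(γ • (M ω + N k ω)) := by
      rw [hX, ringleader_succ (D := D) H.times]
      abel
    rw [h2, inner_neg_right, inner_smul_right, inner_add_right, norm_neg, norm_smul, mul_pow,
      Real.norm_eq_abs, sq_abs] at h1
    have h3 := norm_sub_sq_real (gradient (objective D F) (X k ω)) (M ω)
    -- The vector x^k - W is -γ times the sum of the earlier noises of the round, so the Lipschitz
    -- bound and 2ab ≤ a² + b² suffice.
    have h4 : -(γ * L / 2 * ∑ j ∈ s, (‖N j ω‖ ^ 2 + ‖N k ω‖ ^ 2)) ≤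
        inner ℝ (gradient (objective D F) (X k ω) - gradient (objective D F) (W ω)) (N k ω) := by
      have h5 := abs_real_inner_le_norm
        (gradient (objective D F) (X k ω) - gradient (objective D F) (W ω)) (N k ω)
      have h6 := H.smooth.gradient_lipschitz hn (X k ω) (W ω)
      rw [hW ω, norm_neg, norm_smul, Real.norm_of_nonneg hγ] at h6
      have h7 : ‖∑ j ∈ s, N j ω‖ * ‖N k ω‖ ≤ 1 / 2 * ∑ j ∈ s, (‖N j ω‖ ^ 2 + ‖N k ω‖ ^ 2) := by
        refine (mul_le_mul_of_nonneg_right (norm_sum_le _ _) (norm_nonneg _)).trans ?_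
        rw [Finset.sum_mul, Finset.mul_sum]
        refine Finset.sum_le_sum fun j _ => ?_
        nlinarith [sq_nonneg (‖N j ω‖ - ‖N k ω‖)]
      have h8 : ‖gradient (objective D F) (X k ω) - gradient (objective D F) (W ω)‖ * ‖N k ω‖ ≤
          γ * L / 2 * ∑ j ∈ s, (‖N j ω‖ ^ 2 + ‖N k ω‖ ^ 2) :=
        calc _ ≤ L * (γ * ‖∑ j ∈ s, N j ω‖) * ‖N k ω‖ :=
              mul_le_mul_of_nonneg_right h6 (norm_nonneg _)
          _ = γ * L * (‖∑ j ∈ s, N j ω‖ * ‖N k ω‖) := by ring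
          _ ≤ γ * L * (1 / 2 * ∑ j ∈ s, (‖N j ω‖ ^ 2 + ‖N k ω‖ ^ 2)) :=
              mul_le_mul_of_nonneg_left h7 (by positivity)
          _ = _ := by ring
      linarith [(abs_le.1 (h5.trans h8)).1]
    rw [inner_sub_left] at h4
    have h9 := mul_le_mul_of_nonneg_left h4 hγ
    linarith [congrArg (fun t => γ / 2 * t) h3]
  have j1 := i1.sub i2
  have j2 := j1.add i3
  have j3 := j2.sub i4
  have j4 := j3.add i5
  have hle := integral_mono ((H.integrable_objective hn (hX2 (k + 1))).add
    ((integrable_norm_sq hg2).const_mul (γ / 2))) (j4.add i6) hpt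
  rw [integral_add' j4 i6, integral_add' j3 i5, integral_sub' j2 i4, integral_add' j1 i3,
    integral_sub' i1 i2, integral_add' (H.integrable_objective hn (hX2 (k + 1)))
    ((integrable_norm_sq hg2).const_mul (γ / 2))] at hle
  simp only [integral_const_mul, hzero, Pi.sub_apply, Pi.add_apply] at hle
  have hnoise : ∫ ω, ∑ j ∈ s, (‖N j ω‖ ^ 2 + ‖N k ω‖ ^ 2) ∂P ≤
      (k % n : ℕ) * (2 * noiseBound o σ) := by
    have hNN : ∀ j ∈ s, Integrable (fun ω => ‖N j ω‖ ^ 2 + ‖N k ω‖ ^ 2) P := fun j _ =>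
      (integrable_norm_sq (hN2 j)).add (integrable_norm_sq (hN2 k))
    rw [integral_finsetSum _ hNN]
    have hcard : s.card = k % n := by
      have := Nat.div_add_mod' k n
      rw [hs, Nat.card_Ico]
      omega
    rw [← hcard, ← nsmul_eq_mul]
    refine Finset.sum_le_card_nsmul _ _ _ fun j _ => ?_
    rw [integral_add (integrable_norm_sq (hN2 j)) (integrable_norm_sq (hN2 k))]
    have h1 := H.secondMoment_stepNoise (o := o) (γ := γ) (x₀ := x₀) j
    have h2 := H.secondMoment_stepNoise (o := o) (γ := γ) (x₀ := x₀) k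
    rw [noiseBound]
    linarith
  have hMN := H.integral_norm_mean_add_noise_sq (o := o) (γ := γ) (x₀ := x₀) k
  have e1 := mul_le_mul_of_nonneg_left hnoise (show 0 ≤ γ ^ 2 * L / 2 by positivity)
  have e2 := mul_le_mul_of_nonneg_left hMN (show 0 ≤ L * γ ^ 2 / 2 by positivity)
  have e3 : ∫ ω, ‖M ω‖ ^ 2 ∂P = meanSq o D F ξ γ x₀ P (k / n) := rfl
  rw [e3] at hle
  linarith

/-- The effect of one step, for a stepsize of at most `1 / (8nL)`. -/
theorem integral_objective_step (hγ : 0 ≤ γ) (hγ' : γ * n * L ≤ 1 / 8) (k : ℕ) :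
    ∫ ω, objective D F (ringleader o F ξ γ x₀ (k + 1) ω) ∂P +
        γ / 2 * ∫ ω, ‖gradient (objective D F) (ringleader o F ξ γ x₀ k ω)‖ ^ 2 ∂P ≤
      ∫ ω, objective D F (ringleader o F ξ γ x₀ k ω) ∂P
        - γ / 64 * meanSq o D F ξ γ x₀ P (k / n)
        + γ / 64 * prevMeanSq o D F ξ γ x₀ P (k / n)
        + 5 / 4 * γ * (γ * n * L) * noiseBound o σ := by
  have h1 := H.integral_objective_succ_le (o := o) (x₀ := x₀) hγ k
  have h2 := H.integral_gradient_sub_mean_sq (o := o) (γ := γ) (x₀ := x₀) k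
  have hn : (1 : ℝ) ≤ n := by exact_mod_cast card_pos o
  have hL := H.smooth.pos
  have ha := meanSq_nonneg (o := o) (D := D) (F := F) (ξ := ξ) (γ := γ) (x₀ := x₀) (P := P) (k / n)
  have hb := prevMeanSq_nonneg (o := o) (D := D) (F := F) (ξ := ξ) (γ := γ) (x₀ := x₀) (P := P)
    (k / n)
  have hv := noiseBound_nonneg (o := o) (σ := σ) H.times
  set a := meanSq o D F ξ γ x₀ P (k / n)
  set b := prevMeanSq o D F ξ γ x₀ P (k / n)
  set v := noiseBound o σ
  set t := γ * n * L with ht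
  have ht0 : 0 ≤ t := by positivity
  have h3 := mul_le_mul_of_nonneg_left h2 (show 0 ≤ γ / 2 by positivity)
  -- The gradient error is γ t²(a + b + 2v). For a and b a constant is enough; for v one factor t
  -- must survive, hence two bounds for t².
  have h4 : t ^ 2 ≤ 1 / 64 := by nlinarith
  have h5 : t ^ 2 ≤ t / 8 := by nlinarith
  have h6 : γ * L ≤ t := by
    rw [ht]
    nlinarith [mul_nonneg hγ hL.le]
  have hp : ((k % n : ℕ) : ℝ) + 1 ≤ n := by exact_mod_cast Nat.mod_lt k (card_pos o)
  have e1 : γ * t ^ 2 * (b + a) ≤ γ * (1 / 64) * (b + a) := by gcongr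
  have e2 : γ * t ^ 2 * (2 * v) ≤ γ * (t / 8) * (2 * v) := by gcongr
  -- Cross terms with earlier steps of the round, plus the 1/2 from the noise of the step itself.
  have e3 : γ ^ 2 * L * (((k % n : ℕ) : ℝ) + 1 / 2) * v ≤ γ ^ 2 * L * n * v := by
    gcongr
    linarith
  have e4 : γ ^ 2 * L * n = γ * t := by rw [ht]; ring
  have e5 : γ * (γ * L) * a ≤ γ * (1 / 8) * a := by
    gcongr
    exact h6.trans hγ'
  rw [e4] at e3
  have e6 : 0 ≤ γ * a := by positivity
  -- The coefficient of γa is at most -1/2 + 1/64 + 1/16 ≤ -1/64; that of γtv is 1 + 1/4.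
  linarith

end Setting

end Convergence

/-! ### Properties of the stepsize -/

section Stepsize

variable {n : ℕ} {L ε σ B : ℝ}

theorem stepsize_pos (hn : 0 < n) (hL : 0 < L) (hε : 0 < ε) (hB : 0 < B) :
    0 < stepsize n L ε σ B := by
  have hn' : (0 : ℝ) < n := by exact_mod_cast hn
  rw [stepsize]
  split_ifs with h
  · positivity
  · have : 0 < σ ^ 2 := by positivity
    exact lt_min (by positivity) (by positivity)

theorem stepsize_mul_le (hn : 0 < n) (hL : 0 < L) :
    stepsize n L ε σ B * n * L ≤ 1 / 8 := by
  have hn' : (0 : ℝ) < n := by exact_mod_cast hn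
  have h : stepsize n L ε σ B ≤ 1 / (8 * n * L) := by
    rw [stepsize]
    split_ifs
    · exact le_rfl
    · exact min_le_left _ _
  rw [le_div_iff₀ (by positivity)] at h
  linarith

theorem stepsize_mul_sq_le (hL : 0 < L) (hε : 0 < ε) (hB : 0 < B) :
    stepsize n L ε σ B * L * (σ ^ 2 / B) ≤ ε / 10 := by
  by_cases hσ : σ = 0
  · simp only [hσ, ne_eq, OfNat.ofNat_ne_zero, not_false_eq_true, zero_pow, zero_div, mul_zero]
    positivity
  · have h2 : 0 < σ ^ 2 := by positivity
    have h : stepsize n L ε σ B ≤ ε * B / (10 * L * σ ^ 2) := by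
      rw [stepsize, if_neg hσ]
      exact min_le_right _ _
    calc stepsize n L ε σ B * L * (σ ^ 2 / B)
        ≤ ε * B / (10 * L * σ ^ 2) * L * (σ ^ 2 / B) := by gcongr
      _ = ε / 10 := by field_simp

theorem one_div_stepsize_le (hn : 0 < n) (hL : 0 < L) (hε : 0 < ε) (hB : 0 < B) :
    1 / stepsize n L ε σ B ≤ 8 * n * L + 10 * L * σ ^ 2 / (ε * B) := by
  have hn' : (0 : ℝ) < n := by exact_mod_cast hn
  have h1 : 0 ≤ 10 * L * σ ^ 2 / (ε * B) := by positivity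
  rw [stepsize]
  split_ifs with h
  · rw [one_div_one_div]
    linarith
  · have h2 : 0 < 8 * n * L := by positivity
    rcases min_choice (1 / (8 * n * L)) (ε * B / (10 * L * σ ^ 2)) with h3 | h3 <;> rw [h3]
    · rw [one_div_one_div]
      linarith
    · rw [one_div_div]
      linarith

end Stepsize

/-! ### The rate as a function of the smoothness constant -/

section Rate

variable {n d : ℕ} {τ : Fin n → ℝ}

theorem rate_eq (M Δ ε σ : ℝ) : rate τ M Δ ε σ = M * rate τ 1 Δ ε σ := by
  unfold rate
  ring

theorem rate_one_nonneg (hτ : ∀ i, 0 < τ i) {Δ ε σ : ℝ} (hΔ : 0 ≤ Δ) (hε : 0 < ε) :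
    0 ≤ rate τ 1 Δ ε σ := by
  have h1 : 0 ≤ slowest τ := Real.iSup_nonneg fun i => (hτ i).le
  have h2 : 0 ≤ average τ :=
    mul_nonneg (by positivity) (Finset.sum_nonneg fun i _ => (hτ i).le)
  unfold rate
  positivity

theorem smoothnessConstant_le {φ : Vec d → ℝ} {L : ℝ} (hL : 0 ≤ L)
    (h : ∀ x y, ‖gradient φ x - gradient φ y‖ ≤ L * ‖x - y‖) : smoothnessConstant φ ≤ L :=
  csInf_le ⟨0, fun _ hM => hM.1⟩ ⟨hL, h⟩

end Rate

/-! ### Summation over rounds and the final count -/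

section Main

variable {n d : ℕ} {τ : Fin n → ℝ} {Ξ : Fin n → Type u} [∀ i, MeasurableSpace (Ξ i)]
  {Ω : Type v} [mΩ : MeasurableSpace Ω] {o : ArrivalOrder n τ} {D : ∀ i, Measure (Ξ i)}
  {F : ∀ i, Vec d → Ξ i → ℝ} {ξ : ∀ i : Fin n, ℕ → Ω → Ξ i} {γ : ℝ} {x₀ : Vec d}
  {P : Measure Ω} {L σ : ℝ}

namespace Setting

variable (H : Setting τ D F L σ P ξ) [∀ i, IsProbabilityMeasure (D i)] [IsProbabilityMeasure P]
include H

theorem integral_objective_part (hγ : 0 ≤ γ) (hγ' : γ * n * L ≤ 1 / 8) (r : ℕ) {p : ℕ}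
    (hp : p ≤ n) :
    ∫ ω, objective D F (ringleader o F ξ γ x₀ (r * n + p) ω) ∂P +
        γ / 2 * ∑ q ∈ Finset.range p,
          ∫ ω, ‖gradient (objective D F) (ringleader o F ξ γ x₀ (r * n + q) ω)‖ ^ 2 ∂P ≤
      ∫ ω, objective D F (ringleader o F ξ γ x₀ (r * n) ω) ∂P +
        p * (5 / 4 * γ * (γ * n * L) * noiseBound o σ - γ / 64 * meanSq o D F ξ γ x₀ P r
          + γ / 64 * prevMeanSq o D F ξ γ x₀ P r) := by
  induction p with
  | zero => simp
  | succ p ih =>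
    have h1 := H.integral_objective_step (o := o) (x₀ := x₀) hγ hγ' (r * n + p)
    have h2 : (r * n + p) / n = r :=
      Nat.div_eq_of_lt_le (Nat.le_add_right _ _) (by rw [Nat.add_mul]; omega)
    rw [h2] at h1
    have h3 := ih (by omega)
    rw [Finset.sum_range_succ, ← Nat.add_assoc]
    push_cast
    linarith

/-- The surplus -γ/64 E‖M‖² of the n steps of a round pays for the staleness of the n steps of the
next one. The `prevMeanSq` term is the unspent credit. -/
theorem integral_objective_rounds (hγ : 0 ≤ γ) (hγ' : γ * n * L ≤ 1 / 8) (R : ℕ) :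
    ∫ ω, objective D F (ringleader o F ξ γ x₀ (R * n) ω) ∂P +
        γ / 2 * ∑ k ∈ Finset.range (R * n),
          ∫ ω, ‖gradient (objective D F) (ringleader o F ξ γ x₀ k ω)‖ ^ 2 ∂P +
        n * (γ / 64 * prevMeanSq o D F ξ γ x₀ P R) ≤
      objective D F x₀ + (R * n : ℕ) * (5 / 4 * γ * (γ * n * L) * noiseBound o σ) := by
  induction R with
  | zero => simp [ringleader_zero, prevMeanSq]
  | succ R ih =>
    have h1 := H.integral_objective_part (o := o) (x₀ := x₀) hγ hγ' R le_rfl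
    rw [show (R + 1) * n = R * n + n by rw [Nat.add_mul, Nat.one_mul], Finset.sum_range_add,
      prevMeanSq]
    push_cast at ih ⊢
    linarith

/-- The convergence rate after `R` rounds. -/
theorem average_gradient_sq_le (hγ : 0 < γ) (hγ' : γ * n * L ≤ 1 / 8) {fstar : ℝ}
    (hf : ∀ x, fstar ≤ objective D F x) {R : ℕ} (hR : 0 < R) :
    (1 / ((R * n : ℕ) : ℝ)) * ∑ k ∈ Finset.range (R * n),
        ∫ ω, ‖gradient (objective D F) (ringleader o F ξ γ x₀ k ω)‖ ^ 2 ∂P ≤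
      2 * (objective D F x₀ - fstar) / (γ * (R * n : ℕ)) +
        5 / 2 * (γ * L * (σ ^ 2 / minBatch o)) := by
  have hn := card_pos o
  have h1 := H.integral_objective_rounds (o := o) (x₀ := x₀) hγ.le hγ' R
  have hint := H.integrable_objective hn
    (H.memLp_ringleader (o := o) (γ := γ) (x₀ := x₀) (R * n))
  have h2 : fstar ≤ ∫ ω, objective D F (ringleader o F ξ γ x₀ (R * n) ω) ∂P := by
    have := integral_mono (μ := P) (integrable_const fstar) hint fun ω => hf _
    simpa using this
  have h3 : 0 ≤ n * (γ / 64 * prevMeanSq o D F ξ γ x₀ P R) :=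
    mul_nonneg n.cast_nonneg (mul_nonneg (by positivity) (prevMeanSq_nonneg R))
  have hK : (0 : ℝ) < (R * n : ℕ) := by exact_mod_cast Nat.mul_pos hR hn
  have hn' : (0 : ℝ) < n := by exact_mod_cast hn
  have hB := minBatch_pos (o := o) H.times
  set K : ℝ := ((R * n : ℕ) : ℝ)
  set G := ∑ k ∈ Finset.range (R * n),
        ∫ ω, ‖gradient (objective D F) (ringleader o F ξ γ x₀ k ω)‖ ^ 2 ∂P
  have h4 : γ / 2 * G ≤ objective D F x₀ - fstar +
      K * (5 / 4 * γ * (γ * n * L) * noiseBound o σ) := by linarith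
  have h5 : 1 / K * G = 2 / (γ * K) * (γ / 2 * G) := by field_simp
  rw [h5]
  refine (mul_le_mul_of_nonneg_left h4 (by positivity)).trans_eq ?_
  rw [noiseBound]
  field_simp
  ring

/-- The number of rounds needed for an `ε`-stationary point, and the time that they take. -/
theorem exists_rounds {ε Δ fstar : ℝ} (hε : 0 < ε) (hf : ∀ x, fstar ≤ objective D F x)
    (hΔ : Δ = objective D F x₀ - fstar) (hγ : γ = stepsize n L ε σ (minBatch o)) :
    ∃ K : ℕ, 0 < K ∧ (∀ k < K, iterateTime o k ≤ 240 * rate τ L Δ ε σ) ∧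
      (1 / (K : ℝ)) * ∑ k ∈ Finset.range K,
        ∫ ω, ‖gradient (objective D F) (ringleader o F ξ γ x₀ k ω)‖ ^ 2 ∂P ≤ ε := by
  have hn := card_pos o
  have hn' : (0 : ℝ) < n := by exact_mod_cast hn
  have hL := H.smooth.pos
  have hB := minBatch_pos (o := o) H.times
  have hΔ0 : 0 ≤ Δ := by rw [hΔ]; linarith [hf x₀]
  have hrate : 0 ≤ rate τ L Δ ε σ := by
    rw [rate_eq]
    exact mul_nonneg hL.le (rate_one_nonneg H.times hΔ0 hε)
  -- In the first case x⁰ qualifies at time 0. In the second, 1 ≤ 2LΔ/ε pays for rounding R up.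
  rcases le_or_gt (2 * L * Δ) ε with hsmall | hlarge
  · refine ⟨1, one_pos, fun k hk => ?_, ?_⟩
    · rw [Nat.lt_one_iff.1 hk, iterateTime_zero]
      positivity
    · have h1 := norm_gradient_sq_le H.smooth.differentiable_objective hL
        (H.smooth.gradient_lipschitz hn) hf x₀
      rw [← hΔ] at h1
      simpa [ringleader_zero] using h1.trans hsmall
  have hΔpos : 0 < Δ := by
    by_contra hc
    have : Δ = 0 := le_antisymm (not_lt.1 hc) hΔ0
    rw [this, mul_zero] at hlarge
    linarith
  have hγ0 : 0 < γ := hγ ▸ stepsize_pos hn hL hε hB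
  have hγ1 : γ * n * L ≤ 1 / 8 := hγ ▸ stepsize_mul_le hn hL
  have hγ2 : γ * L * (σ ^ 2 / minBatch o) ≤ ε / 10 := hγ ▸ stepsize_mul_sq_le hL hε hB
  have hγ3 : 1 / γ ≤ 8 * n * L + 10 * L * σ ^ 2 / (ε * minBatch o) :=
    hγ ▸ one_div_stepsize_le hn hL hε hB
  -- Chosen so that 2Δ/(γRn) ≤ ε/2; the noise term adds at most ε/4.
  set R : ℕ := ⌈4 * Δ / (γ * ε * n)⌉₊ with hR
  have hR0 : 0 < R := Nat.ceil_pos.2 (by positivity)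
  have hR1 : 4 * Δ / (γ * ε * n) ≤ R := Nat.le_ceil _
  have hR2 : (R : ℝ) < 4 * Δ / (γ * ε * n) + 1 := Nat.ceil_lt_add_one (by positivity)
  refine ⟨R * n, Nat.mul_pos hR0 hn, fun k hk => ?_, ?_⟩
  · refine (iterateTime_mono H.times hk.le).trans ((iterateTime_le H.times R).trans ?_)
    have hs : 0 < slowest τ := (H.times (worker o 0)).trans_le (le_slowest _)
    have ha := average_pos H.times o
    have h1 : slowest τ / minBatch o ≤ 3 * average τ := by
      have := minBatch_ge (o := o) H.times
      rw [div_le_iff₀ (by positivity)] at this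
      rw [div_le_iff₀ hB]
      linarith
    have h2 : 4 * Δ / (γ * ε * n) = 4 * Δ / (ε * n) * (1 / γ) := by field_simp
    have h3 : (1 : ℝ) ≤ 2 * (L * Δ / ε) := by
      rw [← mul_div_assoc, le_div_iff₀ hε]
      linarith
    have h4 : (R : ℝ) ≤ 4 * Δ / (ε * n) * (8 * n * L + 10 * L * σ ^ 2 / (ε * minBatch o)) +
        2 * (L * Δ / ε) := by
      rw [h2] at hR2
      have := mul_le_mul_of_nonneg_left hγ3 (show 0 ≤ 4 * Δ / (ε * n) by positivity)
      linarith
    -- Constants: 2·4·8 + 2·2 = 68 and 2·4·10 = 80; then τ_n/B ≤ 3τ_avg gives 240.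
    calc 2 * slowest τ * R
        ≤ 2 * slowest τ * (4 * Δ / (ε * n) * (8 * n * L + 10 * L * σ ^ 2 / (ε * minBatch o)) +
          2 * (L * Δ / ε)) := by gcongr
      _ = L * Δ / ε * (68 * slowest τ +
          80 * (slowest τ / minBatch o) * (σ ^ 2 / (n * ε))) := by
        field_simp
        ring
      _ ≤ L * Δ / ε * (240 * slowest τ + 80 * (3 * average τ) * (σ ^ 2 / (n * ε))) := by
        gcongr
        norm_num
      _ = 240 * rate τ L Δ ε σ := by
        unfold rate
        ring
  · refine (H.average_gradient_sq_le hγ0 hγ1 hf hR0).trans ?_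
    rw [← hΔ]
    have h1 : 2 * Δ / (γ * (R * n : ℕ)) ≤ ε / 2 := by
      have hR' : (0 : ℝ) < R := by exact_mod_cast hR0
      rw [div_le_iff₀ (by positivity)] at hR1 ⊢
      push_cast
      linarith
    linarith

end Setting

end Main

end

end Ringleader

theorem mainTheorem1 :
    ∃ C : ℝ, 0 < C ∧
      ∀ (n d : ℕ) (_ : 0 < n)
        -- the fixed computation model
        (τ : Fin n → ℝ) (_ : ∀ i, 0 < τ i) (o : Ringleader.ArrivalOrder n τ)
        -- the problem
        (Ξ : Fin n → Type u) [∀ i, MeasurableSpace (Ξ i)]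
        (D : ∀ i, Measure (Ξ i)) [∀ i, IsProbabilityMeasure (D i)]
        (F : ∀ i, Ringleader.Vec d → Ξ i → ℝ)
        (L σ ε fstar : ℝ) (_ : 0 ≤ σ) (_ : 0 < ε)
        (_ : Ringleader.BoundedVariance D F σ)
        (_ : Ringleader.AveragedSmooth D F L)
        (_ : ∀ x, fstar ≤ Ringleader.objective D F x)
        -- the random data points
        (Ω : Type v) [MeasurableSpace Ω] (P : Measure Ω) [IsProbabilityMeasure P]
        (ξ : ∀ i : Fin n, ℕ → Ω → Ξ i) (_ : Ringleader.IndepSamples D P ξ)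
        -- the starting point and the stepsize
        (x₀ : Ringleader.Vec d) (Δ γ : ℝ) (_ : Δ = Ringleader.objective D F x₀ - fstar)
        (_ : γ = Ringleader.stepsize n L ε σ (Ringleader.minBatch o)),
        -- an `ε`-stationary point is found in time `C (LΔ/ε) (τₙ + τ_avg σ² / (nε))`
        (∃ K : ℕ, 0 < K ∧
          (∀ k < K, Ringleader.iterateTime o k ≤ C * Ringleader.rate τ L Δ ε σ) ∧
          (∀ k < K, Integrable (fun ω => ‖gradient (Ringleader.objective D F)
            (Ringleader.ringleader o F ξ γ x₀ k ω)‖ ^ 2) P) ∧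
          (1 / (K : ℝ)) * ∑ k ∈ Finset.range K, ∫ ω, ‖gradient (Ringleader.objective D F)
            (Ringleader.ringleader o F ξ γ x₀ k ω)‖ ^ 2 ∂P ≤ ε ∧
          ∃ k < K, Ringleader.IsStationary P (Ringleader.objective D F) ε
            (Ringleader.ringleader o F ξ γ x₀ k)) ∧
        -- the rate agrees with the lower-bound expression, up to a constant, if `L = O(L_f)`
        Ringleader.rate τ (Ringleader.smoothnessConstant (Ringleader.objective D F)) Δ ε σ
          ≤ Ringleader.rate τ L Δ ε σ ∧
        ∀ C₀ : ℝ, L ≤ C₀ * Ringleader.smoothnessConstant (Ringleader.objective D F) →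
          Ringleader.rate τ L Δ ε σ ≤ C₀ *
            Ringleader.rate τ (Ringleader.smoothnessConstant (Ringleader.objective D F)) Δ ε σ := by
  refine ⟨240, by norm_num, ?_⟩
  intro n d hn τ hτ o Ξ _ D _ F L σ ε fstar _ hε hV hS hf Ω _ P _ ξ hξ x₀ Δ γ hΔ hγ
  have H : Ringleader.Setting τ D F L σ P ξ := ⟨hτ, hV, hS, hξ⟩
  have hint : ∀ k, Integrable (fun ω => ‖gradient (Ringleader.objective D F)
      (Ringleader.ringleader o F ξ γ x₀ k ω)‖ ^ 2) P := fun k =>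
    Ringleader.integrable_norm_sq (H.memLp_gradient hn (H.memLp_ringleader k))
  have hΔ0 : 0 ≤ Δ := by rw [hΔ]; linarith [hf x₀]
  have hrate := Ringleader.rate_one_nonneg (σ := σ) hτ hΔ0 hε
  have hLf := Ringleader.smoothnessConstant_le hS.pos.le (hS.gradient_lipschitz hn)
  obtain ⟨K, hK, htime, havg⟩ := H.exists_rounds hε hf hΔ hγ
  refine ⟨⟨K, hK, htime, fun k _ => hint k, havg, ?_⟩, ?_, fun C₀ hC₀ => ?_⟩
  · by_contra! hno
    have hlt : ∑ _k ∈ Finset.range K, ε < ∑ k ∈ Finset.range K,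
        ∫ ω, ‖gradient (Ringleader.objective D F)
          (Ringleader.ringleader o F ξ γ x₀ k ω)‖ ^ 2 ∂P :=
      Finset.sum_lt_sum_of_nonempty (Finset.nonempty_range_iff.2 hK.ne') fun k hk => by
        by_contra hc
        exact hno k (Finset.mem_range.1 hk) ⟨hint k, not_lt.1 hc⟩
    have hK' : (0 : ℝ) < K := by exact_mod_cast hK
    rw [Finset.sum_const, Finset.card_range, nsmul_eq_mul] at hlt
    rw [one_div, inv_mul_le_iff₀ hK'] at havg
    linarith
  · rw [Ringleader.rate_eq, Ringleader.rate_eq L]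
    exact mul_le_mul_of_nonneg_right hLf hrate
  · rw [Ringleader.rate_eq, Ringleader.rate_eq (Ringleader.smoothnessConstant _), ← mul_assoc]
    exact mul_le_mul_of_nonneg_right hC₀ hrate
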